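/- **Setting.** Let $n\ge 1$, $\sigma_x,\sigma_w>0$, $\Omega=\sigma_x^2/\sigma_w^2$, $\sigma_y^2=\sigma_x^2+\sigma_w^2$, and let $x\in\mathbb R^n$ with $\|x\|^2=n\sigma_x^2$. Let $p_{y|x}$ be the density of $\mathcal N(x,\sigma_w^2 I_n)$, let $q_y$ be the density of $\mathcal N(0,\sigma_y^2I_n)$, and put $\Lambda(x,y)=\frac1n\ln\frac{p_{y|x}(y|x)}{q_y(y)}$. For $\lambda\in\mathbb R$ let $$P_{MD}(\lambda)=\mathbb P[\Lambda(x,y)<\lambda\mid y\sim p_{y|x}],\qquad P_{FA}(\lambda)=\mathbb P[\Lambda(x,y)\ge\lambda\mid y\sim q_y].$$ The Polyanskiy–Poor–Verdú (PPV) bounds are $$\overline R=-\tfrac1n\log_2P_{FA}(\lambda)\ \text{ with } \lambda \text{ set by } P_{MD}(\lambda)=P_e,\qquad \underline P_e=P_{MD}(\lambda)\ \text{ with } \lambda \text{ set by } -\tfrac1n\log_2P_{FA}(\lambda)=R,$$ for given $0<P_e<1$ and $R>0$ respectively. **Series.** For $\gamma>0$ put $s_\gamma=\sinh\gamma$, $c_\gamma=\cosh\gamma$,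 $\alpha(z)=c_\gamma-\cosh z+s_\gamma(z-\gamma)$, and, for each of the two cases MD and FA, $$\theta=\ln\frac{\Omega}{2s_\gamma}+\begin{cases}0&\text{MD}\\-\ln(1+\Omega)&\text{FA}\end{cases},\qquad s=\operatorname{sign}(\gamma-\theta),\qquad v=-\alpha(\theta)/s_\gamma .$$ Let $t(u)$, $u\in\mathbb R$, be the inverse of $z\mapsto\operatorname{sign}(\Im z)\sqrt{2\alpha(\ln z)}$ (principal branches), with $t(0)=e^\gamma$; let $f(u)=t'(u)/(e^\theta-t(u))$, with Taylor expansion $f(u)=i\sum_kc_ku^k$ at $u=0$. For $K\ge1$ let $$g^{(K)}=\frac1{2\sqrt\pi}\sum_{k=0}^{K-1}c_{2k}\frac{\Gamma(k+\frac12)}{\Gamma(\frac12)}\Big(\frac{4s_\gamma}n\Big)^{k+\frac12},$$ $$P^{(K)}_{MD}(\gamma)=1(s_{MD})+g^{(K)}_{MD}e^{-\frac12nv_{MD}},\qquad P^{(K)}_{FA}(\gamma)=1(-s_{FA})-g^{(K)}_{FA}e^{-\frac12nv_{FA}},$$ where $1(\cdot)$ is the unit step, $1(a)=1$ for $a\ge0$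 and $0$ otherwise. The approximate bounds are $$\overline R^{(K)}=-\tfrac1n\log_2P^{(K)}_{FA}(\gamma)\ \text{ with }\gamma\text{ set by }P^{(K)}_{MD}(\gamma)=P_e,\qquad \underline P_e^{(K)}=P^{(K)}_{MD}(\gamma)\ \text{ with }\gamma\text{ set by }-\tfrac1n\log_2P^{(K)}_{FA}(\gamma)=R,$$ where $P^{(K)}_{FA}(\gamma)>0$ is understood. **Condition.** For $0<\phi<\pi$ put $\operatorname{sinc}\phi=\sin(\phi)/\phi$, $r=\operatorname{asinh}(s_\gamma/\operatorname{sinc}\phi)$, $r'=(1/\phi-\cot\phi)/\sqrt{1+\operatorname{sinc}^2(\phi)/s_\gamma^2}$, $h=(1-\cos\phi)\cosh r+\alpha(r)$, $h'=\sin\phi\,\cosh r\,[1+(r')^2]$, $u(\phi)=\sqrt{2h}$, $$\tilde g=\frac{e^{\theta-r}[\cos\phi+r'\sin\phi]-1}{e^{2(\theta-r)}-2\cos(\phi)e^{\theta-r}+1},\qquad c(\phi)=\tilde g\,u(\phi)/h'.$$ Say that the series condition holds at $\gamma$ for $L,U\ge1$ if $$\tfrac12\ln\Big(1+\frac{\Omega}{1+\Omega}\Big)<\gamma<\tfrac12\ln(1+\Omega)$$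 and, for all $\phi\in(0,\pi)$ and both for MD and for FA, $$1+\sum_{k=1}^{L-1}\frac{c_{2k}}{c_0}u^{2k}(\phi)\ \le\ \frac{c(\phi)}{c_0}\ \le\ 1+\sum_{k=1}^{U-1}\frac{c_{2k}}{c_0}u^{2k}(\phi).$$ **Claim.** If the series condition holds at the thresholds $\gamma$ that define the approximate bounds, then $$\overline R^{(U)}\le\overline R\le\overline R^{(L)},\qquad \underline P_e^{(L)}\le\underline P_e\le\underline P_e^{(U)} .$$ More precisely, each of the four inequalities holds for every threshold $\gamma$ that satisfies the defining constraint of its approximate bound, as soon as $\gamma$ lies in the stated interval and satisfies the half of the series condition concerning the truncation order ($U$ or $L$) in question. -/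

import Mathlib

open MeasureTheory ProbabilityTheory
open scoped NNReal

noncomputable section

namespace AWGN

/-! ### The converse bound through the Neyman-Pearson test

Real vectors of length `n` are functions `Fin n → ℝ`; `σx ^ 2` is the power per symbol of the
codewords and `σw ^ 2` is the noise variance. -/

/-- The signal-to-noise ratio `Ω = σx ^ 2 / σw ^ 2`. -/
def snr (σx σw : ℝ≥0) : ℝ := (σx : ℝ) ^ 2 / (σw : ℝ) ^ 2

/-- Law of the received vector given the transmitted vector `x` (hypothesis `H₁`):
`N(x, σw ^ 2 I)`. -/
def channelLaw {n : ℕ} (σw : ℝ≥0) (x : Fin n → ℝ) : Measure (Fin n → ℝ) :=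
  Measure.pi fun i => gaussianReal (x i) (σw ^ 2)

/-- The auxiliary law `q_y = N(0, σy ^ 2 I)`, `σy ^ 2 = σx ^ 2 + σw ^ 2` (hypothesis `H₀`). -/
def auxLaw (n : ℕ) (σx σw : ℝ≥0) : Measure (Fin n → ℝ) :=
  Measure.pi fun _ => gaussianReal 0 (σx ^ 2 + σw ^ 2)

/-- The normalized log-likelihood ratio `Λ(x, y) = (1 / n) ln (p_{y|x}(y | x) / q_y(y))`. -/
def logLikelihood {n : ℕ} (σx σw : ℝ≥0) (x y : Fin n → ℝ) : ℝ :=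
  1 / (n : ℝ) * Real.log ((∏ i, gaussianPDFReal (x i) (σw ^ 2) (y i)) /
    ∏ i, gaussianPDFReal 0 (σx ^ 2 + σw ^ 2) (y i))

/-- Missed detection probability `P_MD(x, λ) = P[Λ(x, y) < λ | H₁]`. -/
def pMD {n : ℕ} (σx σw : ℝ≥0) (x : Fin n → ℝ) (lam : ℝ) : ℝ :=
  (channelLaw σw x).real {y | logLikelihood σx σw x y < lam}

/-- False alarm probability `P_FA(x, λ) = P[Λ(x, y) ≥ λ | H₀]`. -/
def pFA {n : ℕ} (σx σw : ℝ≥0) (x : Fin n → ℝ) (lam : ℝ) : ℝ :=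
  (auxLaw n σx σw).real {y | lam ≤ logLikelihood σx σw x y}

/-- `Rbar` is the rate bound at error probability `Pe`: `Rbar = -(1 / n) log₂ P_FA(λ)`, with `λ`
set by `P_MD(λ) = Pe`. -/
def IsRateBound {n : ℕ} (σx σw : ℝ≥0) (x : Fin n → ℝ) (Pe Rbar : ℝ) : Prop :=
  ∃ lam : ℝ, pMD σx σw x lam = Pe ∧ Rbar = -(1 / (n : ℝ)) * Real.logb 2 (pFA σx σw x lam)

/-- `Pbar` is the error probability bound at rate `R`: `Pbar = P_MD(λ)`, with `λ` set by
`-(1 / n) log₂ P_FA(λ) = R`. -/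
def IsErrorBound {n : ℕ} (σx σw : ℝ≥0) (x : Fin n → ℝ) (R Pbar : ℝ) : Prop :=
  ∃ lam : ℝ, -(1 / (n : ℝ)) * Real.logb 2 (pFA σx σw x lam) = R ∧ Pbar = pMD σx σw x lam

/-! ### The asymptotic expansion

The threshold is parametrized by `γ > 0`. -/

/-- The two kinds of error: missed detection and false alarm. -/
inductive Err where
  | MD
  | FA

/-- `θ(γ)`. -/
def theta (Ω : ℝ) (e : Err) (γ : ℝ) : ℝ :=
  Real.log (Ω / (2 * Real.sinh γ)) +
    match e with
    | Err.MD => 0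
    | Err.FA => -Real.log (1 + Ω)

/-- `s(γ) = sign(γ - θ(γ))`. -/
def sgn (Ω : ℝ) (e : Err) (γ : ℝ) : ℝ := Real.sign (γ - theta Ω e γ)

/-- The unit step function, with value `1` at `0`. -/
def step (a : ℝ) : ℝ := if 0 ≤ a then 1 else 0

/-- `α(x) = cosh γ - cosh x + (x - γ) sinh γ`. -/
def alpha (γ a : ℝ) : ℝ := Real.cosh γ - Real.cosh a + Real.sinh γ * (a - γ)

/-- The same function `α` at complex arguments. -/
def alphaC (γ : ℝ) (z : ℂ) : ℂ :=
  Complex.cosh (γ : ℂ) - Complex.cosh z + Complex.sinh (γ : ℂ) * (z - (γ : ℂ))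

/-- `v(γ) = -α(θ(γ)) / sinh γ`. -/
def v (Ω : ℝ) (e : Err) (γ : ℝ) : ℝ := -alpha γ (theta Ω e γ) / Real.sinh γ

/-- `z ↦ sign(Im z) √(2 α(ln z))`, with principal square root and logarithm. -/
def tInv (γ : ℝ) (z : ℂ) : ℂ :=
  (Real.sign z.im : ℂ) * (2 * alphaC γ (Complex.log z)) ^ (1 / 2 : ℂ)

/-- The function `t` of a real variable inverse to `tInv`. For `u ≠ 0` there is exactly one complex
number `z` with `tInv γ z = u`; at `u = 0`, where all real numbers are solutions, the value is the
one given by continuity, `exp γ`. -/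
def t (γ u : ℝ) : ℂ :=
  if u = 0 then Complex.exp γ else Classical.epsilon fun z : ℂ => tInv γ z = (u : ℂ)

/-- `f(u) = t'(u) / (exp θ - t(u))`. -/
def f (Ω : ℝ) (e : Err) (γ u : ℝ) : ℂ :=
  deriv (t γ) u / (Complex.exp (theta Ω e γ) - t γ u)

/-- The coefficient `c_j` in the Taylor expansion `f(u) = i ∑ c_j u ^ j` at `u = 0`; only the
coefficients of even index, which are real, are used. -/
def coeff (Ω : ℝ) (e : Err) (γ : ℝ) (j : ℕ) : ℝ :=
  (iteratedDeriv j (f Ω e γ) 0 / ((j.factorial : ℂ) * Complex.I)).re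

/-- The asymptotic series of `g(γ)` limited to the `K` terms `k = 0, …, K - 1`. -/
def gSeries (n : ℕ) (Ω : ℝ) (e : Err) (K : ℕ) (γ : ℝ) : ℝ :=
  1 / (2 * √Real.pi) * ∑ k ∈ Finset.range K,
    coeff Ω e γ (2 * k) * (Real.Gamma ((k : ℝ) + 1 / 2) / Real.Gamma (1 / 2)) *
      (4 * Real.sinh γ / (n : ℝ)) ^ ((k : ℝ) + 1 / 2)

/-- The `K`-term expression `P_MD^(K)`. -/
def pMDApprox (n : ℕ) (Ω : ℝ) (K : ℕ) (γ : ℝ) : ℝ :=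
  step (sgn Ω Err.MD γ) +
    gSeries n Ω Err.MD K γ * Real.exp (-(1 / 2) * (n : ℝ) * v Ω Err.MD γ)

/-- The `K`-term expression `P_FA^(K)`. -/
def pFAApprox (n : ℕ) (Ω : ℝ) (K : ℕ) (γ : ℝ) : ℝ :=
  step (-sgn Ω Err.FA γ) -
    gSeries n Ω Err.FA K γ * Real.exp (-(1 / 2) * (n : ℝ) * v Ω Err.FA γ)

/-- `RK` is the `K`-term rate bound at error probability `Pe` given by the threshold `γ`:
`P_MD^(K)(γ) = Pe` and `RK = -(1 / n) log₂ P_FA^(K)(γ)`. The truncated series can take negative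
values; the logarithm is required to make sense. -/
def IsRateApprox (n : ℕ) (Ω : ℝ) (K : ℕ) (γ Pe RK : ℝ) : Prop :=
  pMDApprox n Ω K γ = Pe ∧ 0 < pFAApprox n Ω K γ ∧
    RK = -(1 / (n : ℝ)) * Real.logb 2 (pFAApprox n Ω K γ)

/-- `PK` is the `K`-term error probability bound at rate `R` given by the threshold `γ`:
`-(1 / n) log₂ P_FA^(K)(γ) = R` and `PK = P_MD^(K)(γ)`. -/
def IsErrorApprox (n : ℕ) (Ω : ℝ) (K : ℕ) (γ R PK : ℝ) : Prop :=
  0 < pFAApprox n Ω K γ ∧ -(1 / (n : ℝ)) * Real.logb 2 (pFAApprox n Ω K γ) = R ∧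
    PK = pMDApprox n Ω K γ

/-! ### The condition under which the truncated series are bounds -/

/-- The range of `γ` in which the two step functions are not active. -/
def InRange (Ω γ : ℝ) : Prop :=
  1 / 2 * Real.log (1 + Ω / (1 + Ω)) < γ ∧ γ < 1 / 2 * Real.log (1 + Ω)

/-- `r(φ) = asinh(sinh γ / sinc φ)`. -/
def r (γ φ : ℝ) : ℝ := Real.arsinh (Real.sinh γ / Real.sinc φ)

/-- The derivative of `r`, in closed form. -/
def rDeriv (γ φ : ℝ) : ℝ :=
  (1 / φ - Real.cot φ) / √(1 + Real.sinc φ ^ 2 / Real.sinh γ ^ 2)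

/-- The function `g̃(φ)`. -/
def gTilde (Ω : ℝ) (e : Err) (γ φ : ℝ) : ℝ :=
  (Real.exp (theta Ω e γ - r γ φ) * (Real.cos φ + rDeriv γ φ * Real.sin φ) - 1) /
    (Real.exp (2 * (theta Ω e γ - r γ φ)) -
      2 * Real.cos φ * Real.exp (theta Ω e γ - r γ φ) + 1)

/-- `h(φ) = (1 - cos φ) cosh r(φ) + α(r(φ))`. -/
def h (γ φ : ℝ) : ℝ := (1 - Real.cos φ) * Real.cosh (r γ φ) + alpha γ (r γ φ)

/-- The derivative of `h`, in closed form. -/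
def hDeriv (γ φ : ℝ) : ℝ := Real.sin φ * Real.cosh (r γ φ) * (1 + rDeriv γ φ ^ 2)

/-- `u(φ) = √(2 h(φ))`. -/
def u (γ φ : ℝ) : ℝ := √(2 * h γ φ)

/-- `c(φ) = g̃(φ) u(φ) / h'(φ)`. -/
def c (Ω : ℝ) (e : Err) (γ φ : ℝ) : ℝ := gTilde Ω e γ φ * u γ φ / hDeriv γ φ

/-- The normalized truncated Taylor series `1 + ∑_{k=1}^{K-1} (c_{2k} / c_0) u(φ) ^ (2k)`. -/
def taylorSum (Ω : ℝ) (e : Err) (K : ℕ) (γ φ : ℝ) : ℝ :=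
  1 + ∑ k ∈ Finset.Icc 1 (K - 1),
    coeff Ω e γ (2 * k) / coeff Ω e γ 0 * u γ φ ^ (2 * k)

/-- Upper half of the sufficient condition, for both kinds of error. At `φ = 0` the formula for
`c(φ)` reads `0 / 0`, and by continuity both sides have the value `1`; the condition is imposed at
the other points of `[0, π)`. -/
def UpperCondition (Ω : ℝ) (U : ℕ) (γ : ℝ) : Prop :=
  ∀ e : Err, ∀ φ ∈ Set.Ioo 0 Real.pi, c Ω e γ φ / coeff Ω e γ 0 ≤ taylorSum Ω e U γ φ

/-- Lower half of the sufficient condition, for both kinds of error. -/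
def LowerCondition (Ω : ℝ) (L : ℕ) (γ : ℝ) : Prop :=
  ∀ e : Err, ∀ φ ∈ Set.Ioo 0 Real.pi, taylorSum Ω e L γ φ ≤ c Ω e γ φ / coeff Ω e γ 0

end AWGN

end

/-! The likelihood ratio is a decreasing affine function of the squared Euclidean distance from
`center` (`logLikelihood_eq`), so both error probabilities concern the squared distance from a fixed
point to a Gaussian vector. Its Laplace transform is explicit, and Laplace inversion writes its
distribution function as an integral over a vertical line; the side of the pole p = 0 on which the
line lies decides whether a 1 is subtracted.

Under the substitution 1 + 2Vp = exp(ζ - θ) the integrand becomes exp(-N α(ζ)) / (exp(θ - ζ) - 1)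
with N = n / (2 sinh γ), up to the constant exp(-n v / 2) (`inversion_integrand_eq`). The line is
placed through the saddle point ζ = γ of α and then moved to the curve ζ = r(φ) + iφ of steepest
descent, on which α is real and equals u² / 2. There the imaginary part of the integrand times dζ is
exp(-N u² / 2) c du. A pointwise bound of c by an even polynomial in u therefore integrates exactly
to Gaussian moments, and these are the terms of `gSeries` (`mul_im_integral_le_gSeries`,
`mul_prob_le_gSeries`). The result holds for each fixed n, with no remainder estimate. Among the
coefficients only c_0 has to be computed, because the condition is normalized by c_0: it is positive
for MD and negative for FA when γ is in range.

At the threshold matched to γ this bounds the true P_MD and P_FA by the truncated expressions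
(`approx_upper`, `approx_lower`). That threshold need not be the one defining the exact bound. The
two are compared through the Neyman-Pearson trade-off: a larger P_MD goes with a smaller P_FA, even
where these functions of the threshold are flat, because the two laws are mutually absolutely
continuous (`pFA_le_of_pMD_le`, `pMD_le_of_pFA_le`). -/

namespace AWGN

open Filter Topology Set

/-! ### Laplace inversion for distribution functions -/

/-- The function of `τ` with bilateral Laplace transform `p ↦ exp (-p q) / p` on the half-plane
`Re p < 0` if `neg` holds, `0 < Re p` otherwise. -/
noncomputable def stepKernel (neg : Prop) [Decidable neg] (q τ : ℝ) : ℝ :=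
  (if q ≤ τ then 1 else 0) - (if neg then 1 else 0)

theorem measurable_stepKernel (neg : Prop) [Decidable neg] :
    Measurable (fun z : ℝ × ℝ => stepKernel neg z.1 z.2) := by
  unfold stepKernel
  exact (Measurable.ite (measurableSet_le measurable_fst measurable_snd) measurable_const
    measurable_const).sub_const _

theorem exp_mul_stepKernel_of_pos (p : ℂ) (q : ℝ) :
    (fun τ : ℝ => Complex.exp (-p * τ) * (stepKernel False q τ : ℂ)) =
      (Ici q).indicator fun τ : ℝ => Complex.exp (-p * τ) := by
  ext τ
  by_cases hτ : q ≤ τ <;> simp [stepKernel, hτ]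

theorem exp_mul_stepKernel_of_neg (p : ℂ) (q : ℝ) :
    (fun τ : ℝ => Complex.exp (-p * τ) * (stepKernel True q τ : ℂ)) =
      -(Iio q).indicator fun τ : ℝ => Complex.exp (-p * τ) := by
  ext τ
  by_cases hτ : q ≤ τ
  · simp [stepKernel, hτ]
  · simp [stepKernel, hτ, not_le.1 hτ]

theorem integrable_exp_mul_stepKernel {p : ℂ} (hp : p.re ≠ 0) (q : ℝ) :
    Integrable fun τ : ℝ => Complex.exp (-p * τ) * (stepKernel (p.re < 0) q τ : ℂ) := by
  rcases hp.lt_or_gt with h | h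
  · simp only [h]
    rw [exp_mul_stepKernel_of_neg]
    refine Integrable.neg ((integrable_indicator_iff measurableSet_Iio).2 ?_)
    exact (integrableOn_exp_mul_complex_Iic (a := -p) (by simpa using h) q).mono_set
      Iio_subset_Iic_self
  · simp only [h.not_gt]
    rw [exp_mul_stepKernel_of_pos]
    refine (integrable_indicator_iff measurableSet_Ici).2 ?_
    rw [integrableOn_Ici_iff_integrableOn_Ioi]
    exact integrableOn_exp_mul_complex_Ioi (a := -p) (by simpa using h) q

theorem integral_exp_mul_stepKernel {p : ℂ} (hp : p.re ≠ 0) (q : ℝ) :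
    ∫ τ : ℝ, Complex.exp (-p * τ) * (stepKernel (p.re < 0) q τ : ℂ) = Complex.exp (-p * q) / p := by
  rcases hp.lt_or_gt with h | h
  · simp only [h]
    rw [exp_mul_stepKernel_of_neg, integral_neg', integral_indicator measurableSet_Iio,
      ← integral_Iic_eq_integral_Iio, integral_exp_mul_complex_Iic (by simpa using h), div_neg,
      neg_neg]
  · simp only [h.not_gt]
    rw [exp_mul_stepKernel_of_pos, integral_indicator measurableSet_Ici,
      integral_Ici_eq_integral_Ioi, integral_exp_mul_complex_Ioi (by simpa using h), neg_div_neg_eq]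

theorem integral_norm_exp_mul_stepKernel {p : ℂ} (hp : p.re ≠ 0) (q : ℝ) :
    ∫ τ : ℝ, ‖Complex.exp (-p * τ) * (stepKernel (p.re < 0) q τ : ℂ)‖ =
      Real.exp (-p.re * q) / |p.re| := by
  have hn : ∀ τ : ℝ, ‖Complex.exp (-p * τ)‖ = Real.exp (-p.re * τ) := fun τ => by
    simp [Complex.norm_exp]
  rcases hp.lt_or_gt with h | h
  · simp only [h, congrFun (exp_mul_stepKernel_of_neg p q), Pi.neg_apply, norm_neg,
      norm_indicator_eq_indicator_norm, hn]
    rw [integral_indicator measurableSet_Iio,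
      ← integral_Iic_eq_integral_Iio, integral_exp_mul_Iic (by simpa using h), abs_of_neg h]
  · simp only [h.not_gt, congrFun (exp_mul_stepKernel_of_pos p q),
      norm_indicator_eq_indicator_norm, hn]
    rw [integral_indicator measurableSet_Ici,
      integral_Ici_eq_integral_Ioi, integral_exp_mul_Ioi (by simpa using h), neg_div_neg_eq,
      abs_of_pos h]

/-- Integrating the norm over τ leaves exp(-Re p · q) / |Re p|, which is ν-integrable by assumption.
This licenses the exchange of integrals in the inversion formula. -/
theorem integrable_prod_exp_mul_stepKernel {ν : Measure ℝ} [IsProbabilityMeasure ν] {p : ℂ}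
    (hp : p.re ≠ 0) (hν : Integrable (fun q => Real.exp (-p.re * q)) ν) :
    Integrable (fun z : ℝ × ℝ => Complex.exp (-p * z.2) * (stepKernel (p.re < 0) z.1 z.2 : ℂ))
      (ν.prod volume) := by
  rw [integrable_prod_iff]
  · refine ⟨ae_of_all _ fun q => integrable_exp_mul_stepKernel hp q, ?_⟩
    simp only [integral_norm_exp_mul_stepKernel hp]
    exact hν.div_const _
  · refine Measurable.aestronglyMeasurable ?_
    have := measurable_stepKernel (p.re < 0)
    fun_prop

theorem integral_stepKernel (ν : Measure ℝ) [IsProbabilityMeasure ν] (neg : Prop) [Decidable neg]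
    (τ : ℝ) :
    ∫ q, stepKernel neg q τ ∂ν = ν.real (Iic τ) - (if neg then 1 else 0) := by
  have h1 : (fun q => (if q ≤ τ then (1:ℝ) else 0)) = (Iic τ).indicator 1 := by
    ext q; simp [indicator]
  unfold stepKernel
  rw [integral_sub, h1, integral_indicator_one measurableSet_Iic]
  · simp
  · rw [h1]; exact (integrable_const (1 : ℝ)).indicator measurableSet_Iic
  · exact integrable_const _

/-- Fourier inversion recovers the value only at a point of continuity; the absence of an atom
provides it, by dominated convergence. -/
theorem continuousAt_measureReal_Iic {ν : Measure ℝ} [IsProbabilityMeasure ν] {ρ : ℝ}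
    (hρ : ν {ρ} = 0) : ContinuousAt (fun τ => ν.real (Iic τ)) ρ := by
  have h1 : ∀ τ, ν.real (Iic τ) = ∫ q, (if q ≤ τ then (1:ℝ) else 0) ∂ν := fun τ => by
    have := integral_stepKernel ν False τ
    simpa [stepKernel] using this.symm
  simp only [h1]
  refine tendsto_integral_filter_of_dominated_convergence (fun _ => 1) ?_ ?_
    (integrable_const _) ?_
  · filter_upwards with τ
    exact (Measurable.ite measurableSet_Iic measurable_const
      measurable_const).aestronglyMeasurable
  · filter_upwards with τ
    filter_upwards with q
    split_ifs <;> simp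
  · have : ∀ᵐ q ∂ν, q ≠ ρ := by simpa [ae_iff] using hρ
    filter_upwards [this] with q hq
    refine tendsto_const_nhds.congr' ?_
    rcases hq.lt_or_gt with h | h
    · filter_upwards [lt_mem_nhds h] with τ hτ
      rw [if_pos h.le, if_pos hτ.le]
    · filter_upwards [gt_mem_nhds h] with τ hτ
      rw [if_neg h.not_ge, if_neg hτ.not_ge]

/-- Laplace inversion for the distribution function of a probability measure. -/
theorem measureReal_Iic_eq_integral {ν : Measure ℝ} [IsProbabilityMeasure ν] {a ρ : ℝ} (ha : a ≠ 0)
    (hν : Integrable (fun q => Real.exp (-a * q)) ν) (hρ : ν {ρ} = 0)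
    (hL : Integrable fun y : ℝ =>
      (∫ q, Complex.exp (-(a + y * Complex.I) * q) ∂ν) / (a + y * Complex.I)) :
    ((ν.real (Iic ρ) - (if a < 0 then 1 else 0) : ℝ) : ℂ) = (1 / (2 * Real.pi) : ℝ) *
      ∫ y : ℝ, Complex.exp ((a + y * Complex.I) * ρ) *
        ((∫ q, Complex.exp (-(a + y * Complex.I) * q) ∂ν) / (a + y * Complex.I)) := by
  set J : ℝ → ℂ := fun y =>
      (∫ q, Complex.exp (-(a + y * Complex.I) * q) ∂ν) / (a + y * Complex.I) with hJ
  -- The distribution function, lowered by 1 when a < 0 and tilted by exp(-aτ), is integrable on the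
  -- whole line. By Fubini its Fourier transform at w is J(2πw), and Fourier inversion at ρ gives
  -- the formula.
  set H : ℝ → ℂ := fun τ => Complex.exp (-(a : ℂ) * τ) *
    ((ν.real (Iic τ) - (if a < 0 then 1 else 0) : ℝ) : ℂ) with hH
  have hHK : ∀ τ, H τ = ∫ q, Complex.exp (-(a:ℂ) * τ) * (stepKernel (a < 0) q τ : ℂ) ∂ν := by
    intro τ
    rw [integral_const_mul, integral_complex_ofReal, integral_stepKernel]
  have hK : ∀ y : ℝ, Integrable (fun z : ℝ × ℝ => Complex.exp (-((a:ℂ) + y * Complex.I) * z.2) *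
      (stepKernel (a < 0) z.1 z.2 : ℂ)) (ν.prod volume) := by
    intro y
    have := integrable_prod_exp_mul_stepKernel (ν := ν) (p := (a:ℂ) + y * Complex.I)
      (by simpa using ha) (by simpa using hν)
    simpa using this
  have hHi : Integrable H := by
    have := (hK 0).integral_prod_right
    simp only [Complex.ofReal_zero, zero_mul, add_zero] at this
    exact this.congr (ae_of_all _ fun τ => (hHK τ).symm)
  have hF : FourierTransform.fourier H = fun w => J (2 * Real.pi * w) := by
    ext w
    rw [Real.fourier_eq']
    have h1 : ∀ τ : ℝ, Complex.exp (↑(-2 * Real.pi * inner ℝ τ w) * Complex.I) • H τ =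
        ∫ q, Complex.exp (-((a:ℂ) + (2 * Real.pi * w : ℝ) * Complex.I) * τ) *
          (stepKernel (a < 0) q τ : ℂ) ∂ν := by
      intro τ
      rw [hHK, ← integral_smul]
      congr 1
      ext q
      rw [smul_eq_mul, ← mul_assoc, ← Complex.exp_add]
      congr 2
      simp
      ring
    simp only [h1]
    rw [← integral_integral_swap (hK (2 * Real.pi * w))]
    have h2 : ∀ q : ℝ, ∫ τ : ℝ, Complex.exp (-((a:ℂ) + (2 * Real.pi * w : ℝ) * Complex.I) * τ) *
          (stepKernel (a < 0) q τ : ℂ) =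
          Complex.exp (-((a:ℂ) + (2 * Real.pi * w : ℝ) * Complex.I) * q) /
            ((a:ℂ) + (2 * Real.pi * w : ℝ) * Complex.I) := by
      intro q
      have := integral_exp_mul_stepKernel (p := (a:ℂ) + (2 * Real.pi * w : ℝ) * Complex.I)
        (by simpa using ha) q
      simpa using this
    simp only [h2]
    rw [integral_div]
  have hc : ContinuousAt H ρ := by
    have h1 := continuousAt_measureReal_Iic hρ
    have h2 : ContinuousAt (fun τ : ℝ => Complex.exp (-(a : ℂ) * τ)) ρ := by fun_prop
    exact h2.mul (Complex.continuous_ofReal.continuousAt.comp (h1.sub continuousAt_const))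
  have h2π : (2 * Real.pi) ≠ 0 := by positivity
  have hFi : Integrable (FourierTransform.fourier H) := by
    rw [hF]
    exact hL.comp_mul_left' h2π
  have key := hHi.fourierInv_fourier_eq hFi hc
  rw [hF, Real.fourierInv_eq'] at key
  have h3 : ∀ w : ℝ, Complex.exp (↑(2 * Real.pi * inner ℝ w ρ) * Complex.I) •
      J (2 * Real.pi * w) = (fun y : ℝ => Complex.exp (y * Complex.I * ρ) * J y)
        (2 * Real.pi * w) := by
    intro w
    simp only [smul_eq_mul]
    congr 2
    simp
    ring
  simp only [h3] at key
  rw [Measure.integral_comp_mul_left (fun y : ℝ => Complex.exp (y * Complex.I * ρ) * J y)] at key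
  have h4 : ∀ y : ℝ, Complex.exp ((a + y * Complex.I) * ρ) * J y =
      Complex.exp (a * ρ) * (Complex.exp (y * Complex.I * ρ) * J y) := by
    intro y
    rw [← mul_assoc, ← Complex.exp_add]; ring_nf
  rw [integral_congr_ae (ae_of_all _ h4)]
  have h5 : |(2 * Real.pi)⁻¹| = 1 / (2 * Real.pi) := by
    rw [abs_of_pos (by positivity), one_div]
  rw [h5, Complex.real_smul] at key
  rw [integral_const_mul, mul_left_comm, key, hH, ← mul_assoc, ← Complex.exp_add]
  simp

/-- The inversion integrand at -y is the conjugate of its value at y, so the full line contributes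
twice the real part of the upper half. Only the half y > 0 is then deformed. -/
theorem measureReal_Iic_eq_re_integral {ν : Measure ℝ} [IsProbabilityMeasure ν] {a ρ : ℝ}
    (ha : a ≠ 0) (hν : Integrable (fun q => Real.exp (-a * q)) ν) (hρ : ν {ρ} = 0)
    (hL : Integrable fun y : ℝ =>
      (∫ q, Complex.exp (-(a + y * Complex.I) * q) ∂ν) / (a + y * Complex.I)) :
    Integrable (fun y : ℝ => Complex.exp ((a + y * Complex.I) * ρ) *
        ((∫ q, Complex.exp (-(a + y * Complex.I) * q) ∂ν) / (a + y * Complex.I))) ∧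
    Real.pi * (ν.real (Iic ρ) - (if a < 0 then 1 else 0)) =
      (∫ y : ℝ in Ioi 0, Complex.exp ((a + y * Complex.I) * ρ) *
        ((∫ q, Complex.exp (-(a + y * Complex.I) * q) ∂ν) / (a + y * Complex.I))).re := by
  have key := measureReal_Iic_eq_integral ha hν hρ hL
  set M : ℝ → ℂ := fun y => Complex.exp ((a + y * Complex.I) * ρ) *
        ((∫ q, Complex.exp (-(a + y * Complex.I) * q) ∂ν) / (a + y * Complex.I)) with hM
  have hMi : Integrable M := by
    refine (hL.bdd_mul (c := Real.exp (a * ρ)) ?_ ?_)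
    · exact Continuous.aestronglyMeasurable (by fun_prop)
    · filter_upwards with y
      simp [Complex.norm_exp]
  refine ⟨hMi, ?_⟩
  have hconj : ∀ y, M (-y) = (starRingEnd ℂ) (M y) := by
    intro y
    simp only [hM, map_mul, map_div₀, ← Complex.exp_conj, ← integral_conj, map_add, map_neg,
      Complex.conj_I, Complex.conj_ofReal]
    push_cast
    ring_nf
  have hre : ∀ y, (M y).re = (M |y|).re := by
    intro y
    rcases abs_choice y with h | h
    · rw [h]
    · rw [h, hconj, Complex.conj_re]
  have h1 := congrArg Complex.re key
  rw [Complex.re_ofReal_mul, Complex.ofReal_re] at h1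
  have h2 : (∫ y, M y).re = ∫ y, (M y).re := (integral_re hMi).symm
  have h3 : (∫ y in Ioi 0, M y).re = ∫ y in Ioi 0, (M y).re := (integral_re hMi.integrableOn).symm
  have h4 : ∫ y, (M y).re = 2 * ∫ y in Ioi 0, (M y).re := by
    rw [← integral_comp_abs (f := fun y => (M y).re)]
    simp only [← hre]
  rw [h1, h2, h3, h4]
  have := Real.pi_pos
  field_simp

/-! ### Gaussian vectors and the Laplace transform of the squared distance -/

theorem pi_absolutelyContinuous {n : ℕ} (μ ν : Fin n → Measure ℝ) [∀ i, SigmaFinite (μ i)]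
    [∀ i, SigmaFinite (ν i)] (hμν : ∀ i, μ i ≪ ν i) : Measure.pi μ ≪ Measure.pi ν := by
  induction n with
  | zero => rw [Measure.pi_of_empty, Measure.pi_of_empty]
  | succ n ih =>
    have hμ := measurePreserving_piFinSuccAbove μ 0
    have hν := measurePreserving_piFinSuccAbove ν 0
    have h1 := (hμν 0).prod (ih (fun j => μ (Fin.succAbove 0 j)) (fun j => ν (Fin.succAbove 0 j))
      fun j => hμν _)
    have h2 := h1.map (MeasurableEquiv.piFinSuccAbove (fun _ => ℝ) (0 : Fin (n + 1))).symm.measurable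
    rwa [(hμ.symm).map_eq, (hν.symm).map_eq] at h2

/-- Squared Euclidean distance from the point `d`. -/
noncomputable def sqDist {n : ℕ} (d y : Fin n → ℝ) : ℝ := ∑ i, (y i - d i) ^ 2

theorem measurable_sqDist {n : ℕ} (d : Fin n → ℝ) : Measurable (sqDist d) := by
  unfold sqDist; fun_prop

/-- The level set is a sphere of positive radius. It is taken in `EuclideanSpace`, since the
distance on `Fin n → ℝ` is the sup distance. -/
theorem volume_sqDist_eq {n : ℕ} (d : Fin n → ℝ) {ρ : ℝ} (hρ : 0 < ρ) :
    volume {y | sqDist d y = ρ} = 0 := by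
  have h1 := Measure.addHaar_sphere_of_ne_zero (volume : Measure (EuclideanSpace ℝ (Fin n)))
    (WithLp.toLp 2 d) (Real.sqrt_pos.2 hρ).ne'
  rw [← (PiLp.volume_preserving_toLp (Fin n)).measure_preimage
    (Metric.isClosed_sphere.measurableSet.nullMeasurableSet)] at h1
  convert h1 using 2
  ext y
  rw [mem_preimage, Metric.mem_sphere, EuclideanSpace.dist_eq,
    Real.sqrt_inj (Finset.sum_nonneg fun _ _ => sq_nonneg _) hρ.le]
  simp [Real.dist_eq, sqDist]

/-- The law of a vector of independent normal variables. -/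
noncomputable def gaussianVec {n : ℕ} (m : Fin n → ℝ) (V : ℝ≥0) : Measure (Fin n → ℝ) :=
  Measure.pi fun i => gaussianReal (m i) V

instance {n : ℕ} (m : Fin n → ℝ) (V : ℝ≥0) : IsProbabilityMeasure (gaussianVec m V) := by
  unfold gaussianVec; infer_instance

theorem gaussianVec_absolutelyContinuous_volume {n : ℕ} (m : Fin n → ℝ) {V : ℝ≥0} (hV : V ≠ 0) :
    gaussianVec m V ≪ volume :=
  pi_absolutelyContinuous _ _ fun _ => gaussianReal_absolutelyContinuous _ hV

theorem volume_absolutelyContinuous_gaussianVec {n : ℕ} (m : Fin n → ℝ) {V : ℝ≥0} (hV : V ≠ 0) :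
    volume ≪ gaussianVec m V :=
  pi_absolutelyContinuous _ _ fun _ => gaussianReal_absolutelyContinuous' _ hV

theorem gaussianPDFReal_smul_cexp (m d : ℝ) {V : ℝ≥0} (hV : V ≠ 0) (p : ℂ) (y : ℝ) :
    gaussianPDFReal m V y • Complex.exp (-p * (y - d) ^ 2) =
      ((√(2 * Real.pi * V))⁻¹ : ℝ) * Complex.exp (-((1 + 2 * V * p) / (2 * V)) * y ^ 2 +
        (m / V + 2 * p * d) * y + (-(m ^ 2 / (2 * V)) - p * d ^ 2)) := by
  have hV' : (V : ℂ) ≠ 0 := by exact_mod_cast hV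
  rw [gaussianPDFReal, Complex.real_smul, Complex.ofReal_mul, mul_assoc, Complex.ofReal_exp,
    ← Complex.exp_add]
  congr 2
  push_cast
  field_simp
  ring

theorem re_div_two_mul_pos {V : ℝ≥0} (hV : V ≠ 0) {w : ℂ} (hw : 0 < w.re) :
    (-(w / (2 * V))).re < 0 := by
  have h1 : w / (2 * V) = w / ((2 * V : ℝ) : ℂ) := by push_cast; rfl
  have : 0 < (V : ℝ) := by positivity
  rw [h1, Complex.neg_re, Complex.div_ofReal_re, neg_lt_zero]
  positivity

theorem integrable_gaussianReal_cexp (m d : ℝ) {V : ℝ≥0} (hV : V ≠ 0) {p : ℂ}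
    (hw : 0 < (1 + 2 * V * p).re) :
    Integrable (fun y : ℝ => Complex.exp (-p * (y - d) ^ 2)) (gaussianReal m V) := by
  rw [gaussianReal_of_var_ne_zero _ hV, integrable_withDensity_iff_integrable_smul'
    (measurable_gaussianPDF _ _) (ae_of_all _ fun _ => gaussianPDF_lt_top)]
  simp only [toReal_gaussianPDF, gaussianPDFReal_smul_cexp m d hV]
  exact (integrable_cexp_quadratic' (re_div_two_mul_pos hV hw) _ _).const_mul _

/-- Completing the square. Since Re (1 + 2Vp) > 0, the principal logarithm is compatible with the
inverse, and writing the square root as exp(-log / 2) lets the product over coordinates become a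
factor n without branch problems. -/
theorem integral_gaussianReal_cexp (m d : ℝ) {V : ℝ≥0} (hV : V ≠ 0) {p : ℂ}
    (hw : 0 < (1 + 2 * V * p).re) :
    ∫ y : ℝ, Complex.exp (-p * (y - d) ^ 2) ∂(gaussianReal m V) =
      Complex.exp (-(1 / 2) * Complex.log (1 + 2 * V * p) +
        (1 / (1 + 2 * V * p) - 1) * ((m - d) ^ 2 / (2 * V))) := by
  have hV' : (V : ℂ) ≠ 0 := by exact_mod_cast hV
  have hV0 : 0 < (V : ℝ) := by positivity
  rw [integral_gaussianReal_eq_integral_smul hV]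
  simp only [gaussianPDFReal_smul_cexp m d hV]
  rw [integral_const_mul, integral_cexp_quadratic (re_div_two_mul_pos hV hw)]
  set w : ℂ := 1 + 2 * V * p with hwdef
  have hw0 : w ≠ 0 := by rintro h; simp [h] at hw
  have hp : p = (w - 1) / (2 * V) := by rw [hwdef]; field_simp; ring
  have hπ : (0:ℝ) < 2 * Real.pi * V := by positivity
  have h1 : (Real.pi : ℂ) / -(-(w / (2 * V))) = ((2 * Real.pi * V : ℝ) : ℂ) * w⁻¹ := by
    push_cast; field_simp
  have harg : w.arg ≠ Real.pi := by
    intro h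
    have := Complex.arg_eq_pi_iff.1 h
    linarith [this.1]
  have hpi0 : ((2 * Real.pi * V : ℝ) : ℂ) ≠ 0 := by exact_mod_cast hπ.ne'
  have h2 : (((√(2 * Real.pi * V))⁻¹ : ℝ) : ℂ) =
      Complex.exp (-(1/2) * Real.log (2 * Real.pi * V)) := by
    rw [Real.sqrt_eq_rpow, ← Real.rpow_neg hπ.le, Real.rpow_def_of_pos hπ]
    push_cast
    ring_nf
  rw [h1, Complex.cpow_def_of_ne_zero (mul_ne_zero hpi0 (inv_ne_zero hw0)),
    Complex.log_ofReal_mul hπ (inv_ne_zero hw0), Complex.log_inv _ harg, h2, ← Complex.exp_add,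
    ← Complex.exp_add]
  congr 1
  rw [hp]
  field_simp
  ring

theorem integrable_gaussianVec_cexp {n : ℕ} (m d : Fin n → ℝ) {V : ℝ≥0} (hV : V ≠ 0) {p : ℂ}
    (hw : 0 < (1 + 2 * V * p).re) :
    Integrable (fun y => Complex.exp (-p * sqDist d y)) (gaussianVec m V) := by
  have : (fun y : Fin n → ℝ => Complex.exp (-p * sqDist d y)) =
      fun y => ∏ i, Complex.exp (-p * (y i - d i) ^ 2) := by
    ext y
    rw [← Complex.exp_sum, ← Finset.mul_sum, sqDist]
    push_cast; rfl
  rw [this]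
  exact Integrable.fintype_prod (f := fun i (y : ℝ) => Complex.exp (-p * (y - d i) ^ 2))
    fun i => integrable_gaussianReal_cexp _ _ hV hw

theorem integral_gaussianVec_cexp {n : ℕ} (m d : Fin n → ℝ) {V : ℝ≥0} (hV : V ≠ 0) {p : ℂ}
    (hw : 0 < (1 + 2 * V * p).re) :
    ∫ y, Complex.exp (-p * sqDist d y) ∂(gaussianVec m V) =
      Complex.exp (-(n / 2) * Complex.log (1 + 2 * V * p) +
        (1 / (1 + 2 * V * p) - 1) * (sqDist d m / (2 * V))) := by
  have : (fun y : Fin n → ℝ => Complex.exp (-p * sqDist d y)) =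
      fun y => ∏ i, Complex.exp (-p * (y i - d i) ^ 2) := by
    ext y
    rw [← Complex.exp_sum, ← Finset.mul_sum, sqDist]
    push_cast; rfl
  rw [this, gaussianVec, integral_fintype_prod_eq_prod
    (f := fun i (y : ℝ) => Complex.exp (-p * (y - d i) ^ 2))]
  simp only [integral_gaussianReal_cexp _ _ hV hw]
  rw [← Complex.exp_sum, Finset.sum_add_distrib, Finset.sum_const, ← Finset.mul_sum,
    ← Finset.sum_div, sqDist]
  simp only [Finset.card_univ, Fintype.card_fin, nsmul_eq_mul]
  push_cast
  ring_nf

/-- The law of the squared distance from `d` of a normal vector. -/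
noncomputable def sqDistLaw {n : ℕ} (m d : Fin n → ℝ) (V : ℝ≥0) : Measure ℝ :=
  (gaussianVec m V).map (sqDist d)

instance {n : ℕ} (m d : Fin n → ℝ) (V : ℝ≥0) : IsProbabilityMeasure (sqDistLaw m d V) :=
  Measure.isProbabilityMeasure_map (measurable_sqDist d).aemeasurable

theorem integral_sqDistLaw_cexp {n : ℕ} (m d : Fin n → ℝ) {V : ℝ≥0} (hV : V ≠ 0) {p : ℂ}
    (hw : 0 < (1 + 2 * V * p).re) :
    ∫ q : ℝ, Complex.exp (-p * q) ∂(sqDistLaw m d V) =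
      Complex.exp (-(n / 2) * Complex.log (1 + 2 * V * p) +
        (1 / (1 + 2 * V * p) - 1) * (sqDist d m / (2 * V))) := by
  rw [sqDistLaw, integral_map (measurable_sqDist d).aemeasurable
    (Continuous.aestronglyMeasurable (by fun_prop)), integral_gaussianVec_cexp m d hV hw]

theorem integrable_sqDistLaw_exp {n : ℕ} (m d : Fin n → ℝ) {V : ℝ≥0} (hV : V ≠ 0) {a : ℝ}
    (hw : 0 < 1 + 2 * V * a) :
    Integrable (fun q => Real.exp (-a * q)) (sqDistLaw m d V) := by
  rw [sqDistLaw, integrable_map_measure (Continuous.aestronglyMeasurable (by fun_prop))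
    (measurable_sqDist d).aemeasurable]
  have := (integrable_gaussianVec_cexp m d hV (p := a)
    (by simpa [← Complex.ofReal_ofNat, -Complex.ofReal_ofNat] using hw)).norm
  refine this.congr (ae_of_all _ fun y => ?_)
  simp [Complex.norm_exp]

theorem sqDistLaw_singleton {n : ℕ} (m d : Fin n → ℝ) {V : ℝ≥0} (hV : V ≠ 0) {ρ : ℝ}
    (hρ : 0 < ρ) : sqDistLaw m d V {ρ} = 0 := by
  rw [sqDistLaw, Measure.map_apply (measurable_sqDist d) (measurableSet_singleton _)]
  exact gaussianVec_absolutelyContinuous_volume m hV (volume_sqDist_eq d hρ)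

/-- On the line, |1 + 2Vp| and |p| both grow at least like √(1 + y²). As n ≥ 1, one factor |1 +
2Vp|^(-1/2) can be spared from the transform; with 1 / |p| it gives the decay (1 + y²)^(-3/4), which
is integrable. -/
theorem integrable_laplace_div {n : ℕ} (hn : 1 ≤ n) {V S : ℝ} (hV : 0 < V) (hS : 0 ≤ S) {a : ℝ}
    (ha : a ≠ 0) (hw : 0 < 1 + 2 * V * a) :
    Integrable fun y : ℝ => Complex.exp (-(n / 2) * Complex.log (1 + 2 * V * (a + y * Complex.I)) +
        (1 / (1 + 2 * V * (a + y * Complex.I)) - 1) * (S / (2 * V))) / (a + y * Complex.I) := by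
  set w0 : ℝ := 1 + 2 * V * a with hw0
  set w : ℝ → ℂ := fun y => 1 + 2 * V * (a + y * Complex.I) with hwdef
  have hre : ∀ y, (w y).re = w0 := fun y => by simp [hwdef, hw0]
  have him : ∀ y, (w y).im = 2 * V * y := fun y => by simp [hwdef]
  have hslit : ∀ y, w y ∈ Complex.slitPlane := fun y => Or.inl (by rw [hre]; exact hw)
  have hne : ∀ y, w y ≠ 0 := fun y => Complex.slitPlane_ne_zero (hslit y)
  have hane : ∀ y : ℝ, (a + y * Complex.I : ℂ) ≠ 0 := fun y h => ha (by simpa using congrArg Complex.re h)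
  have hwc : Continuous w := by fun_prop
  have hcont : Continuous fun y : ℝ => Complex.exp (-(n / 2) * Complex.log (w y) +
        (1 / (w y) - 1) * (S / (2 * V))) / (a + y * Complex.I) := by
    refine Continuous.div ?_ (by fun_prop) hane
    refine Complex.continuous_exp.comp ?_
    exact (continuous_const.mul (hwc.clog hslit)).add
      (((continuous_const.div hwc hne).sub continuous_const).mul continuous_const)
  -- One constant serves for both lower bounds κ √(1 + y²) ≤ |1 + 2Vp| and κ √(1 + y²) ≤ |p|.
  obtain ⟨κ, hκ, hκa, hκw⟩ : ∃ κ : ℝ, 0 < κ ∧ κ ^ 2 ≤ a ^ 2 ∧ κ ^ 2 ≤ 1 ∧ κ ≤ w0 ∧ κ ≤ 2 * V := by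
    refine ⟨min |a| (min 1 (min w0 (2 * V))), by positivity, ?_, ?_, ?_, ?_⟩
    · rw [← sq_abs a]
      gcongr
      exact min_le_left _ _
    · rw [sq_le_one_iff₀ (by positivity)]
      exact (min_le_right _ _).trans (min_le_left _ _)
    · exact (min_le_right _ _).trans ((min_le_right _ _).trans (min_le_left _ _))
    · exact (min_le_right _ _).trans ((min_le_right _ _).trans (min_le_right _ _))
  obtain ⟨hκ1, hκw, hκV⟩ := hκw
  set E : ℝ := Real.exp ((1 / w0) * (S / (2 * V))) with hE
  have hdom : Integrable fun y : ℝ => E * w0 ^ (-((n:ℝ) - 1) / 2) * κ ^ (-(1:ℝ)/2) * κ⁻¹ *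
      (1 + ‖y‖ ^ 2) ^ (-(3 / 2 : ℝ) / 2) :=
    (integrable_rpow_neg_one_add_norm_sq (by simp; norm_num)).const_mul _
  refine hdom.mono' hcont.aestronglyMeasurable (ae_of_all _ fun y => ?_)
  have hn0 : 0 < ‖w y‖ := norm_pos_iff.2 (hne y)
  have hsq : 0 < 1 + y ^ 2 := by positivity
  have hwn : κ * √(1 + y ^ 2) ≤ ‖w y‖ := by
    rw [Complex.norm_def]
    apply Real.le_sqrt_of_sq_le
    rw [mul_pow, Real.sq_sqrt hsq.le, Complex.normSq_apply, hre, him]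
    have e1 : κ ^ 2 ≤ w0 ^ 2 := by gcongr
    have e2 : κ ^ 2 ≤ (2 * V) ^ 2 := by gcongr
    nlinarith [sq_nonneg y]
  have hpn : κ * √(1 + y ^ 2) ≤ ‖(a + y * Complex.I : ℂ)‖ := by
    rw [Complex.norm_def]
    apply Real.le_sqrt_of_sq_le
    rw [mul_pow, Real.sq_sqrt hsq.le, Complex.normSq_apply]
    simp
    nlinarith [sq_nonneg y]
  have hwge : w0 ≤ ‖w y‖ := by rw [← hre y]; exact Complex.re_le_norm _
  have hexp : ‖Complex.exp (-(n / 2) * Complex.log (w y) + (1 / (w y) - 1) * (S / (2 * V)))‖ ≤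
      E * ‖w y‖ ^ (-(n:ℝ) / 2) := by
    rw [Complex.norm_exp, Real.rpow_def_of_pos hn0, hE, ← Real.exp_add, Real.exp_le_exp]
    have e1 : ((-(n / 2) * Complex.log (w y) : ℂ)).re = Real.log ‖w y‖ * (-(n:ℝ) / 2) := by
      have : (-(n / 2) : ℂ) = ((-(n:ℝ) / 2 : ℝ) : ℂ) := by push_cast; ring
      rw [this, Complex.re_ofReal_mul, Complex.log_re]; ring
    have e2 : (((1 / (w y) - 1) * (S / (2 * V)) : ℂ)).re = ((1 / w y).re - 1) * (S / (2 * V)) := by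
      have : (S / (2 * V) : ℂ) = ((S / (2 * V) : ℝ) : ℂ) := by push_cast; ring
      rw [this, Complex.re_mul_ofReal]; simp
    have e3 : (1 / w y).re ≤ 1 / w0 := by
      refine (Complex.re_le_norm _).trans ?_
      rw [norm_div, norm_one]
      gcongr
    rw [Complex.add_re, e1, e2]
    have : 0 ≤ S / (2 * V) := by positivity
    nlinarith
  have hpow : ‖w y‖ ^ (-(n:ℝ) / 2) ≤ w0 ^ (-((n:ℝ) - 1) / 2) * (κ * √(1 + y ^ 2)) ^ (-(1:ℝ) / 2) := by
    have : -(n:ℝ) / 2 = -((n:ℝ) - 1) / 2 + -(1:ℝ) / 2 := by ring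
    rw [this, Real.rpow_add hn0]
    have hn' : (1:ℝ) ≤ n := by exact_mod_cast hn
    gcongr ?_ * ?_
    · exact Real.rpow_le_rpow_of_nonpos hw hwge (by linarith)
    · exact Real.rpow_le_rpow_of_nonpos (by positivity) hwn (by norm_num)
  rw [norm_div]
  have hfin : (κ * √(1 + y ^ 2)) ^ (-(1:ℝ) / 2) / (κ * √(1 + y ^ 2)) =
      κ ^ (-(1:ℝ)/2) * κ⁻¹ * (1 + ‖y‖ ^ 2) ^ (-(3 / 2 : ℝ) / 2) := by
    rw [Real.mul_rpow hκ.le (by positivity), Real.sqrt_eq_rpow, ← Real.rpow_mul hsq.le,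
      Real.norm_eq_abs, sq_abs]
    have e : (1 + y ^ 2) ^ (-(3 / 2 : ℝ) / 2) = (1 + y ^ 2) ^ ((1 / 2 : ℝ) * (-1 / 2)) /
        (1 + y ^ 2) ^ (1 / 2 : ℝ) := by
      rw [← Real.rpow_sub hsq]; norm_num
    rw [e]
    have : 0 < (1 + y ^ 2) ^ (1 / 2 : ℝ) := by positivity
    field_simp
  calc _ ≤ E * (w0 ^ (-((n:ℝ) - 1) / 2) * (κ * √(1 + y ^ 2)) ^ (-(1:ℝ) / 2)) /
        (κ * √(1 + y ^ 2)) := by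
        gcongr
        exact hexp.trans (by gcongr)
    _ = E * w0 ^ (-((n:ℝ) - 1) / 2) * ((κ * √(1 + y ^ 2)) ^ (-(1:ℝ) / 2) / (κ * √(1 + y ^ 2))) := by
        ring
    _ = _ := by rw [hfin]; ring

/-- The distribution function of the squared norm of a normal vector, by Laplace inversion. -/
theorem sqDistLaw_eq_re_integral {n : ℕ} (hn : 1 ≤ n) (m d : Fin n → ℝ) {V : ℝ≥0} (hV : V ≠ 0)
    {a ρ : ℝ} (ha : a ≠ 0) (hw : 0 < 1 + 2 * V * a) (hρ : 0 < ρ) :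
    Integrable (fun y : ℝ => Complex.exp ((a + y * Complex.I) * ρ) *
        (Complex.exp (-(n / 2) * Complex.log (1 + 2 * V * (a + y * Complex.I)) +
        (1 / (1 + 2 * V * (a + y * Complex.I)) - 1) * (sqDist d m / (2 * V))) /
          (a + y * Complex.I))) ∧
    Real.pi * ((gaussianVec m V).real {y | sqDist d y ≤ ρ} - (if a < 0 then 1 else 0)) =
      (∫ y : ℝ in Ioi 0, Complex.exp ((a + y * Complex.I) * ρ) *
        (Complex.exp (-(n / 2) * Complex.log (1 + 2 * V * (a + y * Complex.I)) +
        (1 / (1 + 2 * V * (a + y * Complex.I)) - 1) * (sqDist d m / (2 * V))) /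
          (a + y * Complex.I))).re := by
  have hV0 : 0 < (V : ℝ) := by positivity
  have hL : ∀ y : ℝ, ∫ q : ℝ, Complex.exp (-(a + y * Complex.I) * q) ∂(sqDistLaw m d V) =
      Complex.exp (-(n / 2) * Complex.log (1 + 2 * V * (a + y * Complex.I)) +
        (1 / (1 + 2 * V * (a + y * Complex.I)) - 1) * (sqDist d m / (2 * V))) := fun y =>
    integral_sqDistLaw_cexp m d hV (by simpa using hw)
  have hS : 0 ≤ sqDist d m := Finset.sum_nonneg fun _ _ => sq_nonneg _
  have := measureReal_Iic_eq_re_integral ha (integrable_sqDistLaw_exp m d hV hw)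
    (sqDistLaw_singleton m d hV hρ) (by
      simp only [hL]
      exact integrable_laplace_div hn hV0 hS ha hw)
  simp only [hL] at this
  rwa [sqDistLaw, map_measureReal_apply (measurable_sqDist d) measurableSet_Iic] at this

/-! ### Calculus of `r`, `h` and `u` on [0, π) -/

theorem sinc_pos {φ : ℝ} (h0 : 0 ≤ φ) (hπ : φ < Real.pi) : 0 < Real.sinc φ := by
  rcases h0.eq_or_lt with rfl | h0
  · simp
  · rw [Real.sinc_of_ne_zero h0.ne']
    exact div_pos (Real.sin_pos_of_pos_of_lt_pi h0 hπ) h0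

theorem sinh_r (γ φ : ℝ) : Real.sinh (r γ φ) = Real.sinh γ / Real.sinc φ := Real.sinh_arsinh _

theorem sinh_r_mul_sin {γ φ : ℝ} (hφ : φ ∈ Ioo 0 Real.pi) :
    Real.sinh (r γ φ) * Real.sin φ = Real.sinh γ * φ := by
  have hs := Real.sin_pos_of_pos_of_lt_pi hφ.1 hφ.2
  have := hφ.1
  rw [sinh_r, Real.sinc_of_ne_zero hφ.1.ne']
  field_simp

theorem r_zero (γ : ℝ) : r γ 0 = γ := by simp [r]

theorem h_zero (γ : ℝ) : h γ 0 = 0 := by simp [h, r_zero, alpha]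

theorem continuousAt_r {γ φ : ℝ} (h0 : 0 ≤ φ) (hπ : φ < Real.pi) : ContinuousAt (r γ) φ := by
  unfold r
  exact Real.continuous_arsinh.continuousAt.comp
    (continuousAt_const.div Real.continuous_sinc.continuousAt (sinc_pos h0 hπ).ne')

theorem continuousAt_h {γ φ : ℝ} (h0 : 0 ≤ φ) (hπ : φ < Real.pi) : ContinuousAt (h γ) φ := by
  have := continuousAt_r (γ := γ) h0 hπ
  unfold h alpha
  fun_prop

/-- Since sinh r = sinh γ / sinc φ, the square root in `rDeriv` is coth r. The resulting relation is
what differentiating sinh r · sin φ = φ sinh γ yields. -/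
theorem rDeriv_mul_cosh {γ φ : ℝ} (hγ : 0 < γ) (hφ : φ ∈ Ioo 0 Real.pi) :
    rDeriv γ φ * Real.cosh (r γ φ) = Real.sinh (r γ φ) * (1 / φ - Real.cot φ) := by
  have hs : 0 < Real.sinh γ := Real.sinh_pos_iff.2 hγ
  have hc := sinc_pos hφ.1.le hφ.2
  have : √(1 + Real.sinc φ ^ 2 / Real.sinh γ ^ 2) =
      Real.cosh (r γ φ) / Real.sinh (r γ φ) := by
    rw [Real.sqrt_eq_iff_mul_self_eq_of_pos]
    · have := Real.cosh_sq (r γ φ)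
      have h1 := sinh_r γ φ
      have h2 : 0 < Real.sinh (r γ φ) := by rw [h1]; positivity
      rw [div_mul_div_comm, ← sq, ← sq, this, h1]
      field_simp
    · have h2 : 0 < Real.sinh (r γ φ) := by rw [sinh_r]; positivity
      have := Real.cosh_pos (r γ φ)
      positivity
  rw [rDeriv, this]
  have h2 : 0 < Real.sinh (r γ φ) := by rw [sinh_r]; positivity
  have := Real.cosh_pos (r γ φ)
  field_simp

theorem hasDerivAt_r {γ φ : ℝ} (hγ : 0 < γ) (hφ : φ ∈ Ioo 0 Real.pi) :
    HasDerivAt (r γ) (rDeriv γ φ) φ := by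
  have hsin := Real.sin_pos_of_pos_of_lt_pi hφ.1 hφ.2
  have h0 := hφ.1
  have h1 : HasDerivAt (fun φ => Real.sinh γ * φ / Real.sin φ)
      (Real.sinh (r γ φ) * (1 / φ - Real.cot φ)) φ := by
    convert! ((hasDerivAt_id φ).const_mul (Real.sinh γ)).div (Real.hasDerivAt_sin φ) hsin.ne' using 1
    rw [sinh_r, Real.sinc_of_ne_zero hφ.1.ne', Real.cot_eq_cos_div_sin]
    simp only [id]
    field_simp
  have h2 := h1.arsinh
  have heq : (fun φ => Real.arsinh (Real.sinh γ * φ / Real.sin φ)) =ᶠ[𝓝 φ] r γ := by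
    filter_upwards [isOpen_Ioi.mem_nhds hφ.1] with x hx
    rw [r, Real.sinc_of_ne_zero (ne_of_gt hx), div_div_eq_mul_div]
  convert! h2.congr_of_eventuallyEq heq.symm using 1
  have h3 : Real.sinh γ * φ / Real.sin φ = Real.sinh (r γ φ) := by
    rw [← sinh_r_mul_sin hφ, mul_div_cancel_right₀ _ hsin.ne']
  have := Real.cosh_pos (r γ φ)
  rw [h3, ← rDeriv_mul_cosh hγ hφ, add_comm, ← Real.cosh_sq, Real.sqrt_sq this.le]
  simp; field_simp

theorem hasDerivAt_h {γ φ : ℝ} (hγ : 0 < γ) (hφ : φ ∈ Ioo 0 Real.pi) :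
    HasDerivAt (h γ) (hDeriv γ φ) φ := by
  have hsin := Real.sin_pos_of_pos_of_lt_pi hφ.1 hφ.2
  have h0 := hφ.1
  have hr := hasDerivAt_r hγ hφ
  have := (((Real.hasDerivAt_cos φ).const_sub 1).mul hr.cosh).add
    ((hr.cosh.const_sub (Real.cosh γ)).add ((hr.sub_const γ).const_mul (Real.sinh γ)))
  convert! this using 1
  have h1 : Real.sinh γ = Real.sinh (r γ φ) * Real.sin φ / φ := by
    rw [sinh_r_mul_sin hφ, mul_div_cancel_right₀ _ h0.ne']
  have h2 : rDeriv γ φ * Real.cosh (r γ φ) * Real.sin φ =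
      Real.sinh (r γ φ) * (Real.sin φ / φ - Real.cos φ) := by
    rw [rDeriv_mul_cosh hγ hφ, Real.cot_eq_cos_div_sin]; field_simp
  rw [hDeriv]
  -- The coefficient of r' in h' is sinh γ - cos φ sinh r; this identity turns it into r' cosh r sin
  -- φ and so produces the factor 1 + r'².
  have h3 : Real.sinh γ - Real.cos φ * Real.sinh (r γ φ) =
      rDeriv γ φ * Real.cosh (r γ φ) * Real.sin φ := by rw [h2, h1]; ring
  linear_combination (-rDeriv γ φ) * h3

theorem hDeriv_pos {γ φ : ℝ} (hφ : φ ∈ Ioo 0 Real.pi) : 0 < hDeriv γ φ := by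
  have hsin := Real.sin_pos_of_pos_of_lt_pi hφ.1 hφ.2
  have := Real.cosh_pos (r γ φ)
  unfold hDeriv
  positivity

theorem strictMonoOn_h {γ : ℝ} (hγ : 0 < γ) : StrictMonoOn (h γ) (Ico 0 Real.pi) := by
  apply strictMonoOn_of_deriv_pos (convex_Ico _ _)
  · exact fun φ hφ => (continuousAt_h hφ.1 hφ.2).continuousWithinAt
  · intro φ hφ
    rw [interior_Ico] at hφ
    rw [(hasDerivAt_h hγ hφ).deriv]
    exact hDeriv_pos hφ

theorem h_pos {γ φ : ℝ} (hγ : 0 < γ) (hφ : φ ∈ Ioo 0 Real.pi) : 0 < h γ φ := by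
  have := strictMonoOn_h hγ ⟨le_rfl, Real.pi_pos⟩ (Ioo_subset_Ico_self hφ) hφ.1
  rwa [h_zero] at this

theorem u_zero (γ : ℝ) : u γ 0 = 0 := by simp [u, h_zero]

theorem u_pos {γ φ : ℝ} (hγ : 0 < γ) (hφ : φ ∈ Ioo 0 Real.pi) : 0 < u γ φ :=
  Real.sqrt_pos.2 (mul_pos two_pos (h_pos hγ hφ))

theorem u_sq {γ φ : ℝ} (hγ : 0 < γ) (hφ : φ ∈ Ioo 0 Real.pi) : u γ φ ^ 2 = 2 * h γ φ :=
  Real.sq_sqrt (mul_pos two_pos (h_pos hγ hφ)).le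

theorem strictMonoOn_u {γ : ℝ} (hγ : 0 < γ) : StrictMonoOn (u γ) (Ico 0 Real.pi) := by
  intro a ha b hb hab
  have h1 := strictMonoOn_h hγ ha hb hab
  have h2 : 0 ≤ h γ a := by
    have := (strictMonoOn_h hγ).monotoneOn ⟨le_rfl, Real.pi_pos⟩ ha ha.1
    rwa [h_zero] at this
  exact Real.sqrt_lt_sqrt (by positivity) (by linarith)

theorem hasDerivAt_u {γ φ : ℝ} (hγ : 0 < γ) (hφ : φ ∈ Ioo 0 Real.pi) :
    HasDerivAt (u γ) (hDeriv γ φ / u γ φ) φ := by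
  have h1 := ((hasDerivAt_h hγ hφ).const_mul 2).sqrt (mul_pos two_pos (h_pos hγ hφ)).ne'
  convert! h1 using 1
  rw [u]; field_simp

theorem continuousAt_u {γ φ : ℝ} (h0 : 0 ≤ φ) (hπ : φ < Real.pi) : ContinuousAt (u γ) φ :=
  ((continuousAt_h h0 hπ).const_mul 2).sqrt

theorem tendsto_r_pi {γ : ℝ} (hγ : 0 < γ) : Tendsto (r γ) (𝓝[<] Real.pi) atTop := by
  have hs : 0 < Real.sinh γ := Real.sinh_pos_iff.2 hγ
  have h1 : Tendsto Real.sinc (𝓝[<] Real.pi) (𝓝[>] 0) := by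
    rw [tendsto_nhdsWithin_iff]
    constructor
    · have := (Real.continuous_sinc.tendsto Real.pi).mono_left
        (nhdsWithin_le_nhds (s := Iio Real.pi))
      rwa [Real.sinc_of_ne_zero Real.pi_ne_zero, Real.sin_pi, zero_div] at this
    · filter_upwards [Ioo_mem_nhdsLT Real.pi_pos] with x hx
      exact sinc_pos hx.1.le hx.2
  have h2 : Tendsto (fun φ => Real.sinh γ / Real.sinc φ) (𝓝[<] Real.pi) atTop := by
    simp_rw [div_eq_mul_inv]
    exact (tendsto_inv_nhdsGT_zero.comp h1).const_mul_atTop hs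
  have h3 : Tendsto Real.arsinh atTop atTop := Real.sinhOrderIso.symm.tendsto_atTop
  exact h3.comp h2

/-- Once cos φ ≤ 0, the hyperbolic cosines in h add up to a nonnegative quantity and leave h ≥ sinh
γ (r - γ). -/
theorem tendsto_u_pi {γ : ℝ} (hγ : 0 < γ) : Tendsto (u γ) (𝓝[<] Real.pi) atTop := by
  have hs : 0 < Real.sinh γ := Real.sinh_pos_iff.2 hγ
  have h1 : Tendsto (fun φ => 2 * (Real.sinh γ * (r γ φ - γ))) (𝓝[<] Real.pi) atTop :=
    ((tendsto_atTop_add_const_right _ (-γ) (tendsto_r_pi hγ)).const_mul_atTop hs).const_mul_atTop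
      two_pos
  have h2 : Tendsto (fun φ => 2 * h γ φ) (𝓝[<] Real.pi) atTop := by
    refine tendsto_atTop_mono' _ ?_ h1
    filter_upwards [Ioo_mem_nhdsLT (show Real.pi / 2 < Real.pi by linarith [Real.pi_pos])] with φ hφ
    have hc : Real.cos φ ≤ 0 := Real.cos_nonpos_of_pi_div_two_le_of_le hφ.1.le
      (by linarith [hφ.2, Real.pi_pos])
    have := Real.cosh_pos (r γ φ)
    have := Real.cosh_pos γ
    unfold h alpha
    nlinarith
  exact Real.tendsto_sqrt_atTop.comp h2

/-- The curve leaves the saddle point vertically. Near 0 the numerator 1/φ - cot φ equals (sin φ - φ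
cos φ) / (φ sin φ), at most (φ³ / 2) / (2φ² / π) = πφ / 4. -/
theorem tendsto_rDeriv_zero {γ : ℝ} (hγ : 0 < γ) : Tendsto (rDeriv γ) (𝓝[>] 0) (𝓝 0) := by
  have h1 : Tendsto (fun φ : ℝ => Real.pi * φ / 4) (𝓝[>] 0) (𝓝 0) := by
    have : Tendsto (fun φ : ℝ => Real.pi * φ / 4) (𝓝 0) (𝓝 (Real.pi * 0 / 4)) :=
      Continuous.tendsto (by fun_prop) _
    simpa using this.mono_left nhdsWithin_le_nhds
  refine squeeze_zero_norm' ?_ h1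
  filter_upwards [Ioo_mem_nhdsGT (show (0:ℝ) < Real.pi / 2 by positivity)] with φ hφ
  have hπ := Real.pi_pos
  have h0 := hφ.1
  have hsin := Real.sin_pos_of_pos_of_lt_pi hφ.1 (by linarith [hφ.2])
  have hnum : 0 ≤ 1 / φ - Real.cot φ := by
    rw [Real.cot_eq_cos_div_sin, sub_nonneg, div_le_div_iff₀ hsin hφ.1]
    have := Real.le_tan hφ.1.le hφ.2
    rw [Real.tan_eq_sin_div_cos, le_div_iff₀ (Real.cos_pos_of_mem_Ioo ⟨by linarith, hφ.2⟩)] at this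
    linarith
  have hsq : 1 ≤ √(1 + Real.sinc φ ^ 2 / Real.sinh γ ^ 2) := by
    rw [Real.one_le_sqrt]
    have : 0 ≤ Real.sinc φ ^ 2 / Real.sinh γ ^ 2 := by positivity
    linarith
  rw [rDeriv, Real.norm_of_nonneg (div_nonneg hnum (by linarith))]
  refine (div_le_self hnum hsq).trans ?_
  have hlow : 2 / Real.pi * φ ≤ Real.sin φ := Real.mul_le_sin hφ.1.le hφ.2.le
  have hcos : 1 - φ ^ 2 / 2 ≤ Real.cos φ := Real.one_sub_sq_div_two_le_cos
  have hle : Real.sin φ ≤ φ := (Real.sin_lt hφ.1).le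
  have : 1 / φ - Real.cot φ = (Real.sin φ - φ * Real.cos φ) / (φ * Real.sin φ) := by
    rw [Real.cot_eq_cos_div_sin]; field_simp
  rw [this, div_le_iff₀ (by positivity)]
  have e1 : Real.sin φ - φ * Real.cos φ ≤ φ ^ 3 / 2 := by nlinarith
  have e2 : φ ^ 3 / 2 = Real.pi * φ / 4 * (φ * (2 / Real.pi * φ)) := by field_simp; norm_num
  rw [e2] at e1
  exact e1.trans (by gcongr)

/-- By l'Hôpital's rule, since h' ~ φ cosh γ. Hence u ~ φ √(cosh γ), which fixes the size of t'(0).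
-/
theorem tendsto_h_div_sq {γ : ℝ} (hγ : 0 < γ) :
    Tendsto (fun φ => h γ φ / φ ^ 2) (𝓝[>] 0) (𝓝 (Real.cosh γ / 2)) := by
  have hev : ∀ᶠ φ in 𝓝[>] (0:ℝ), φ ∈ Ioo 0 Real.pi := Ioo_mem_nhdsGT Real.pi_pos
  have hr : Tendsto (r γ) (𝓝[>] 0) (𝓝 γ) := by
    have := (continuousAt_r (γ := γ) le_rfl Real.pi_pos).tendsto.mono_left
      (nhdsWithin_le_nhds (s := Ioi 0))
    rwa [r_zero] at this
  refine HasDerivAt.lhopital_zero_nhdsGT (f' := hDeriv γ) (g' := fun φ => 2 * φ) ?_ ?_ ?_ ?_ ?_ ?_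
  · filter_upwards [hev] with φ hφ using hasDerivAt_h hγ hφ
  · filter_upwards with φ
    simpa using hasDerivAt_pow 2 φ
  · filter_upwards [hev] with φ hφ
    have := hφ.1
    positivity
  · have := (continuousAt_h (γ := γ) le_rfl Real.pi_pos).tendsto.mono_left
      (nhdsWithin_le_nhds (s := Ioi 0))
    rwa [h_zero] at this
  · have : Tendsto (fun φ : ℝ => φ ^ 2) (𝓝 0) (𝓝 (0 ^ 2)) := Continuous.tendsto (by fun_prop) _
    simpa using this.mono_left (nhdsWithin_le_nhds (s := Ioi 0))
  · have hs : Tendsto Real.sinc (𝓝[>] 0) (𝓝 1) := by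
      simpa using (Real.continuous_sinc.tendsto 0).mono_left (nhdsWithin_le_nhds (s := Ioi 0))
    have h1 := (hs.mul ((Real.continuous_cosh.tendsto γ).comp hr)).mul
      (((tendsto_rDeriv_zero hγ).pow 2).const_add 1) |>.div_const 2
    have h2 : (1 * Real.cosh γ * (1 + 0 ^ 2) / 2 : ℝ) = Real.cosh γ / 2 := by ring
    rw [h2] at h1
    refine h1.congr' ?_
    filter_upwards [hev] with φ hφ
    have := hφ.1
    simp only [Function.comp, hDeriv, Real.sinc_of_ne_zero this.ne']
    field_simp

theorem tendsto_u_div {γ : ℝ} (hγ : 0 < γ) :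
    Tendsto (fun φ => u γ φ / φ) (𝓝[>] 0) (𝓝 √(Real.cosh γ)) := by
  have h1 := ((tendsto_h_div_sq hγ).const_mul 2).sqrt
  rw [mul_div_cancel₀ _ two_ne_zero] at h1
  refine h1.congr' ?_
  filter_upwards [Ioo_mem_nhdsGT Real.pi_pos] with φ hφ
  rw [u, ← mul_div_assoc, Real.sqrt_div' _ (sq_nonneg φ), Real.sqrt_sq hφ.1.le]

theorem hasDerivWithinAt_r_zero {γ : ℝ} (hγ : 0 < γ) : HasDerivWithinAt (r γ) 0 (Ici 0) 0 := by
  refine hasDerivWithinAt_Ici_of_tendsto_deriv (s := Ioo 0 Real.pi) ?_ ?_ ?_ ?_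
  · exact fun φ hφ => (hasDerivAt_r hγ hφ).differentiableAt.differentiableWithinAt
  · exact (continuousAt_r le_rfl Real.pi_pos).continuousWithinAt
  · exact Ioo_mem_nhdsGT Real.pi_pos
  · refine (tendsto_rDeriv_zero hγ).congr' ?_
    filter_upwards [Ioo_mem_nhdsGT Real.pi_pos] with φ hφ
    exact (hasDerivAt_r hγ hφ).deriv.symm

theorem exists_u_eq {γ x : ℝ} (hγ : 0 < γ) (hx : 0 < x) : ∃ φ ∈ Ioo 0 Real.pi, u γ φ = x := by
  have hev := ((tendsto_u_pi hγ).eventually_gt_atTop x).and (Ioo_mem_nhdsLT Real.pi_pos)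
  obtain ⟨b, hb, hb0, hbπ⟩ := hev.exists
  have hc : ContinuousOn (u γ) (Icc 0 b) := fun φ hφ =>
    (continuousAt_u hφ.1 (hφ.2.trans_lt hbπ)).continuousWithinAt
  obtain ⟨φ, hφ, he⟩ := intermediate_value_Ioo hb0.le hc (show x ∈ Ioo (u γ 0) (u γ b) by
    rw [u_zero]; exact ⟨hx, hb⟩)
  exact ⟨φ, ⟨hφ.1, hφ.2.trans hbπ⟩, he⟩

/-! ### Deforming the vertical line to the path of steepest descent -/

/-- The integrand of the Laplace inversion integral in the logarithmic coordinate `ζ`. -/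
noncomputable def logIntegrand (N γ θ : ℝ) (ζ : ℂ) : ℂ :=
  Complex.exp (-N * alphaC γ ζ) / (Complex.exp (θ - ζ) - 1)

/-- The strip `0 < Im ζ < π`. -/
def upperStrip : Set ℂ := {ζ | 0 < ζ.im} ∩ {ζ | ζ.im < Real.pi}

theorem isOpen_upperStrip : IsOpen upperStrip :=
  (isOpen_lt continuous_const Complex.continuous_im).inter
    (isOpen_lt Complex.continuous_im continuous_const)

theorem convex_upperStrip : Convex ℝ upperStrip :=
  (convex_halfSpace_im_gt 0).inter (convex_halfSpace_im_lt Real.pi)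

/-- The poles θ + 2πik lie outside the open strip, so no residue appears when the contour is moved
within it. -/
theorem exp_sub_ne_one_of_mem_upperStrip (θ : ℝ) {ζ : ℂ} (hζ : ζ ∈ upperStrip) :
    Complex.exp (θ - ζ) - 1 ≠ 0 := by
  intro h0
  have h1 := congrArg Complex.im h0
  rw [Complex.sub_im, Complex.exp_im] at h1
  simp at h1
  exact (Real.sin_pos_of_pos_of_lt_pi hζ.1 hζ.2).ne' h1

theorem differentiable_alphaC (γ : ℝ) : Differentiable ℂ (alphaC γ) := by
  unfold alphaC; fun_prop

theorem differentiableOn_logIntegrand (N γ θ : ℝ) :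
    DifferentiableOn ℂ (logIntegrand N γ θ) upperStrip := by
  unfold logIntegrand
  have := differentiable_alphaC γ
  exact DifferentiableOn.div (Differentiable.differentiableOn (by fun_prop))
    (Differentiable.differentiableOn (by fun_prop)) fun ζ hζ =>
    exp_sub_ne_one_of_mem_upperStrip θ hζ

/-- The strip is convex and the integrand holomorphic there. A primitive replaces Cauchy's theorem:
two contours are compared through its values near their ends. -/
theorem exists_primitive_logIntegrand (N γ θ : ℝ) :
    ∃ Φ : ℂ → ℂ, ∀ ζ ∈ upperStrip, HasDerivAt Φ (logIntegrand N γ θ ζ) ζ := by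
  obtain ⟨Φ, hΦ⟩ := convex_upperStrip.exists_forall_hasDerivWithinAt
    (differentiableOn_logIntegrand N γ θ)
  exact ⟨Φ, fun ζ hζ => (hΦ ζ hζ).hasDerivAt (isOpen_upperStrip.mem_nhds hζ)⟩

theorem exists_bound_logIntegrand_nhds (N : ℝ) {γ θ : ℝ} (hθ : θ ≠ γ) :
    ∃ M δ : ℝ, 0 < δ ∧ ∀ ζ ∈ Metric.ball (γ : ℂ) δ, ‖logIntegrand N γ θ ζ‖ ≤ M := by
  have hc : ContinuousAt (logIntegrand N γ θ) γ := by
    have := (differentiable_alphaC γ).continuous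
    unfold logIntegrand
    refine ContinuousAt.div (by fun_prop) (by fun_prop) ?_
    rw [← Complex.ofReal_sub, ← Complex.ofReal_exp, ← Complex.ofReal_one, ← Complex.ofReal_sub,
      Complex.ofReal_ne_zero, sub_ne_zero]
    simpa [sub_eq_zero] using hθ
  have := hc.norm.eventually (gt_mem_nhds (lt_add_one _))
  obtain ⟨δ, hδ, h⟩ := Metric.eventually_nhds_iff_ball.1 this
  exact ⟨_, δ, hδ, fun ζ hζ => (h ζ hζ).le⟩

theorem re_alphaC (γ : ℝ) (ζ : ℂ) : (alphaC γ ζ).re =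
    Real.cosh γ - Real.cosh ζ.re * Real.cos ζ.im + Real.sinh γ * (ζ.re - γ) := by
  conv_lhs => rw [← Complex.re_add_im ζ]
  rw [alphaC, Complex.cosh_add, Complex.cosh_mul_I, Complex.sinh_mul_I]
  simp only [← Complex.ofReal_cosh, ← Complex.ofReal_sinh, ← Complex.ofReal_cos,
    ← Complex.ofReal_sin]
  simp [-Complex.ofReal_cosh, -Complex.ofReal_sinh, -Complex.ofReal_cos, -Complex.ofReal_sin]

theorem im_alphaC (γ : ℝ) (ζ : ℂ) : (alphaC γ ζ).im =
    - Real.sinh ζ.re * Real.sin ζ.im + Real.sinh γ * ζ.im := by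
  conv_lhs => rw [← Complex.re_add_im ζ]
  rw [alphaC, Complex.cosh_add, Complex.cosh_mul_I, Complex.sinh_mul_I]
  simp only [← Complex.ofReal_cosh, ← Complex.ofReal_sinh, ← Complex.ofReal_cos,
    ← Complex.ofReal_sin]
  simp [-Complex.ofReal_cosh, -Complex.ofReal_sinh, -Complex.ofReal_cos, -Complex.ofReal_sin]

/-- The path of steepest descent in logarithmic coordinates. -/
noncomputable def descentPath (γ φ : ℝ) : ℂ := r γ φ + φ * Complex.I

theorem descentPath_re (γ φ : ℝ) : (descentPath γ φ).re = r γ φ := by simp [descentPath]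

theorem descentPath_im (γ φ : ℝ) : (descentPath γ φ).im = φ := by simp [descentPath]

/-- The vanishing of Im α is the equation sinh r · sin φ = φ sinh γ that defines r; this is why the
path is one of constant phase. -/
theorem alphaC_descentPath {γ φ : ℝ} (hφ : φ ∈ Ioo 0 Real.pi) :
    alphaC γ (descentPath γ φ) = h γ φ := by
  apply Complex.ext
  · rw [re_alphaC, descentPath_re, descentPath_im, Complex.ofReal_re, h, alpha]
    ring
  · rw [im_alphaC, descentPath_re, descentPath_im, Complex.ofReal_im, neg_mul, sinh_r_mul_sin hφ]
    ring

theorem descentPath_mem {γ φ : ℝ} (hφ : φ ∈ Ioo 0 Real.pi) : descentPath γ φ ∈ upperStrip := by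
  constructor
  · simpa only [mem_ofPred_eq, descentPath_im] using hφ.1
  · simpa only [mem_ofPred_eq, descentPath_im] using hφ.2

theorem hasDerivAt_descentPath {γ φ : ℝ} (hγ : 0 < γ) (hφ : φ ∈ Ioo 0 Real.pi) :
    HasDerivAt (descentPath γ) (rDeriv γ φ + Complex.I) φ := by
  have h1 := (hasDerivAt_r hγ hφ).ofReal_comp
  have h2 := (Complex.ofRealCLM.hasDerivAt (x := φ)).mul_const Complex.I
  simpa using! h1.add h2

/-- On the path the exponential is real and factors out. What remains is the imaginary part of (r' +
i) / (exp(θ - ζ) - 1), and the denominator of `gTilde` is the squared modulus of exp(θ - ζ) - 1. -/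
theorem im_logIntegrand_descentPath (N : ℝ) {Ω : ℝ} {e : Err} {γ φ : ℝ}
    (hφ : φ ∈ Ioo 0 Real.pi) :
    (logIntegrand N γ (theta Ω e γ) (descentPath γ φ) * (rDeriv γ φ + Complex.I)).im =
      Real.exp (-N * h γ φ) * gTilde Ω e γ φ := by
  set θ := theta Ω e γ
  have hden : Complex.exp (θ - descentPath γ φ) - 1 =
      ((Real.exp (θ - r γ φ) * Real.cos φ - 1 : ℝ) : ℂ) -
        (Real.exp (θ - r γ φ) * Real.sin φ : ℝ) * Complex.I := by
    have : (θ - descentPath γ φ : ℂ) = ((θ - r γ φ : ℝ) : ℂ) + ((-φ : ℝ) : ℂ) * Complex.I := by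
      rw [descentPath]; push_cast; ring
    rw [this, Complex.exp_add, Complex.exp_mul_I]
    push_cast
    simp
    ring
  rw [logIntegrand, alphaC_descentPath hφ]
  have hexp : Complex.exp (-N * h γ φ) = (Real.exp (-N * h γ φ) : ℂ) := by push_cast; rfl
  rw [hexp, div_mul_eq_mul_div, mul_div_assoc, Complex.im_ofReal_mul]
  congr 1
  obtain ⟨X, hX⟩ : ∃ X, X = Real.exp (θ - r γ φ) * Real.cos φ - 1 := ⟨_, rfl⟩
  obtain ⟨Z, hZ⟩ : ∃ Z, Z = Real.exp (θ - r γ φ) * Real.sin φ := ⟨_, rfl⟩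
  rw [← hX, ← hZ] at hden
  have hnz : Complex.normSq (Complex.exp (θ - descentPath γ φ) - 1) =
      Real.exp (2 * (θ - r γ φ)) - 2 * Real.cos φ * Real.exp (θ - r γ φ) + 1 := by
    rw [hden, Complex.normSq_apply, two_mul (θ - r γ φ), Real.exp_add]
    simp
    rw [hX, hZ]
    linear_combination Real.exp (θ - r γ φ) ^ 2 * Real.sin_sq_add_cos_sq φ
  rw [Complex.div_im, hnz, hden, gTilde, ← sub_div]
  congr 1
  simp
  rw [hX, hZ]
  ring

/-- The vertical line through `exp γ`, in logarithmic coordinates. -/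
noncomputable def linePath (γ κ y : ℝ) : ℂ := Complex.log (Real.exp γ + κ * y * Complex.I)

theorem linePoint_mem_slitPlane (γ κ y : ℝ) :
    (Real.exp γ + κ * y * Complex.I : ℂ) ∈ Complex.slitPlane :=
  Or.inl (by simp [-Complex.ofReal_exp, Real.exp_pos])

theorem exp_linePath (γ κ y : ℝ) :
    Complex.exp (linePath γ κ y) = Real.exp γ + κ * y * Complex.I :=
  Complex.exp_log (Complex.slitPlane_ne_zero (linePoint_mem_slitPlane γ κ y))

theorem linePath_im_mem {κ y : ℝ} (γ : ℝ) (hκ : 0 < κ) (hy : 0 < y) :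
    (linePath γ κ y).im ∈ Ioo 0 (Real.pi / 2) := by
  rw [linePath, Complex.log_im]
  have hre : 0 < (Real.exp γ + κ * y * Complex.I : ℂ).re := by
    simp [-Complex.ofReal_exp, Real.exp_pos]
  have him : 0 < (Real.exp γ + κ * y * Complex.I : ℂ).im := by
    simp [-Complex.ofReal_exp]; positivity
  refine ⟨?_, (abs_lt.1 (Complex.abs_arg_lt_pi_div_two_iff.2 (Or.inl hre))).2⟩
  refine lt_of_le_of_ne (Complex.arg_nonneg_iff.2 him.le) fun h => ?_
  exact him.ne' (Complex.arg_eq_zero_iff.1 h.symm).2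

theorem linePath_mem {κ y : ℝ} (γ : ℝ) (hκ : 0 < κ) (hy : 0 < y) :
    linePath γ κ y ∈ upperStrip := by
  have := linePath_im_mem γ hκ hy
  exact ⟨this.1, by rw [mem_ofPred_eq]; linarith [this.2, Real.pi_pos]⟩

theorem exp_re_mul_cos_linePath (γ κ y : ℝ) :
    Real.exp (linePath γ κ y).re * Real.cos (linePath γ κ y).im = Real.exp γ := by
  rw [← Complex.exp_re, exp_linePath]
  simp [-Complex.ofReal_exp]

theorem hasDerivAt_linePath (γ κ y : ℝ) :
    HasDerivAt (linePath γ κ) (κ * Complex.I / (Real.exp γ + κ * y * Complex.I)) y := by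
  have h1 : HasDerivAt (fun y : ℝ => (Real.exp γ + κ * y * Complex.I : ℂ)) (κ * Complex.I) y := by
    have := (((Complex.ofRealCLM.hasDerivAt (x := y)).const_mul (κ : ℂ)).mul_const
      Complex.I).const_add (Real.exp γ : ℂ)
    simpa using! this
  exact h1.clog_real (linePoint_mem_slitPlane γ κ y)

theorem continuous_linePath (γ κ : ℝ) : Continuous (linePath γ κ) :=
  continuous_iff_continuousAt.2 fun y => (hasDerivAt_linePath γ κ y).continuousAt

theorem linePath_zero (γ κ : ℝ) : linePath γ κ 0 = γ := by
  simp [linePath, ← Complex.ofReal_log (Real.exp_pos γ).le, -Complex.ofReal_exp]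

theorem linePath_re_eq {γ κ R : ℝ} (hκ : 0 < κ) (hR : γ ≤ R) :
    (linePath γ κ (√(Real.exp R ^ 2 - Real.exp γ ^ 2) / κ)).re = R := by
  have h0 : 0 ≤ Real.exp R ^ 2 - Real.exp γ ^ 2 := by
    have : Real.exp γ ≤ Real.exp R := Real.exp_le_exp.2 hR
    have := Real.exp_pos γ
    nlinarith
  rw [linePath, Complex.log_re, Complex.norm_def, Complex.normSq_apply]
  have e1 : (Real.exp γ + κ * ((√(Real.exp R ^ 2 - Real.exp γ ^ 2) / κ : ℝ) : ℂ) * Complex.I).re =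
      Real.exp γ := by simp [-Complex.ofReal_exp]
  have e2 : (Real.exp γ + κ * ((√(Real.exp R ^ 2 - Real.exp γ ^ 2) / κ : ℝ) : ℂ) * Complex.I).im =
      √(Real.exp R ^ 2 - Real.exp γ ^ 2) := by
    rw [Complex.add_im, Complex.mul_I_im, ← Complex.ofReal_mul, Complex.ofReal_re,
      Complex.ofReal_im, zero_add]
    field_simp
  rw [e1, e2, Real.mul_self_sqrt h0]
  have : Real.exp γ * Real.exp γ + (Real.exp R ^ 2 - Real.exp γ ^ 2) = Real.exp R ^ 2 := by ring
  rw [this, Real.sqrt_sq (Real.exp_pos R).le, Real.log_exp]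

/-- The hypothesis on the cosine says that exp ζ is not to the right of the vertical line through
exp γ. It gives cosh(Re ζ) cos(Im ζ) ≤ exp γ, so Re α grows linearly in Re ζ; the denominator has
modulus at least 1/2 because θ + 1 ≤ Re ζ. -/
theorem norm_logIntegrand_le {N γ θ : ℝ} (hN : 0 ≤ N) {ζ : ℂ} (hre : 0 ≤ ζ.re)
    (hθ : θ + 1 ≤ ζ.re) (hcos : Real.exp ζ.re * Real.cos ζ.im ≤ Real.exp γ) :
    ‖logIntegrand N γ θ ζ‖ ≤
      2 * Real.exp (N * Real.exp γ) * Real.exp (-N * Real.sinh γ * (ζ.re - γ)) := by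
  have hden : 1 / 2 ≤ ‖Complex.exp (θ - ζ) - 1‖ := by
    have h1 : ‖Complex.exp (θ - ζ)‖ ≤ 1 / 2 := by
      rw [Complex.norm_exp]
      have h2 : Real.exp ((θ - ζ : ℂ).re) ≤ Real.exp (-1) := by
        rw [Real.exp_le_exp]; simp; linarith
      have h3 : Real.exp (-1) ≤ 1 / 2 := by
        rw [Real.exp_neg, one_div]
        have := Real.add_one_le_exp (1 : ℝ)
        exact inv_anti₀ two_pos (by linarith)
      exact h2.trans h3
    have := norm_sub_norm_le (1 : ℂ) (Complex.exp (θ - ζ))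
    rw [norm_one, norm_sub_rev] at this
    linarith
  have hnum : ‖Complex.exp (-N * alphaC γ ζ)‖ ≤
      Real.exp (N * Real.exp γ) * Real.exp (-N * Real.sinh γ * (ζ.re - γ)) := by
    rw [Complex.norm_exp, ← Real.exp_add, Real.exp_le_exp, ← Complex.ofReal_neg,
      Complex.re_ofReal_mul, re_alphaC]
    have h1 : Real.cosh ζ.re * Real.cos ζ.im ≤ Real.exp γ := by
      rcases le_or_gt (Real.cos ζ.im) 0 with hc | hc
      · have := Real.cosh_pos ζ.re
        have := Real.exp_pos γ
        nlinarith
      · have : Real.cosh ζ.re ≤ Real.exp ζ.re := by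
          rw [Real.cosh_eq]
          have : Real.exp (-ζ.re) ≤ Real.exp ζ.re := Real.exp_le_exp.2 (by linarith)
          linarith
        exact (mul_le_mul_of_nonneg_right this hc.le).trans hcos
    have h2 := Real.cosh_pos γ
    have h3 : 0 ≤ N * (Real.exp γ - Real.cosh ζ.re * Real.cos ζ.im) :=
      mul_nonneg hN (by linarith)
    have h4 : 0 ≤ N * Real.cosh γ := mul_nonneg hN h2.le
    nlinarith
  rw [logIntegrand, norm_div, div_le_iff₀ (by linarith)]
  have : 0 ≤ Real.exp (N * Real.exp γ) * Real.exp (-N * Real.sinh γ * (ζ.re - γ)) := by positivity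
  nlinarith

/-- The point of the path at angle φ and the point of the line with the same real part R = r(φ) are
joined by a vertical segment of length at most π. On it the integrand is O(exp(-N sinh γ (R - γ))),
and R tends to infinity. -/
theorem tendsto_primitive_sub_top {N γ θ κ : ℝ} (hN : 0 < N) (hγ : 0 < γ) (hκ : 0 < κ) {Φ : ℂ → ℂ}
    (hΦ : ∀ ζ ∈ upperStrip, HasDerivAt Φ (logIntegrand N γ θ ζ) ζ) :
    Tendsto (fun φ => Φ (descentPath γ φ) -
      Φ (linePath γ κ (√(Real.exp (r γ φ) ^ 2 - Real.exp γ ^ 2) / κ))) (𝓝[<] Real.pi) (𝓝 0) := by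
  have hs : 0 < Real.sinh γ := Real.sinh_pos_iff.2 hγ
  have hlim : Tendsto (fun φ => 2 * Real.exp (N * Real.exp γ) *
      Real.exp (-N * Real.sinh γ * (r γ φ - γ)) * Real.pi) (𝓝[<] Real.pi) (𝓝 0) := by
    have h1 : Tendsto (fun φ => -N * Real.sinh γ * (r γ φ - γ)) (𝓝[<] Real.pi) atBot :=
      (tendsto_atTop_add_const_right _ (-γ) (tendsto_r_pi hγ)).const_mul_atTop_of_neg
        (by nlinarith [mul_pos hN hs])
    have := ((Real.tendsto_exp_atBot.comp h1).const_mul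
      (2 * Real.exp (N * Real.exp γ))).mul_const Real.pi
    simpa using this
  refine squeeze_zero_norm' ?_ hlim
  filter_upwards [Ioo_mem_nhdsLT (show Real.pi / 2 < Real.pi by linarith [Real.pi_pos]),
    (tendsto_r_pi hγ).eventually_ge_atTop (θ + 1), (tendsto_r_pi hγ).eventually_gt_atTop γ]
    with φ hφ hRθ hRγ
  have hφ' : φ ∈ Ioo 0 Real.pi := ⟨by linarith [hφ.1, Real.pi_pos], hφ.2⟩
  set R := r γ φ
  set y := √(Real.exp R ^ 2 - Real.exp γ ^ 2) / κ
  have hy : 0 < y := by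
    have h1 : Real.exp γ < Real.exp R := Real.exp_lt_exp.2 hRγ
    have h2 := Real.exp_pos γ
    have h3 : 0 < Real.exp R ^ 2 - Real.exp γ ^ 2 := by nlinarith
    positivity
  have hre : (linePath γ κ y).re = R := linePath_re_eq hκ hRγ.le
  have him := linePath_im_mem γ hκ hy
  have hcosy := exp_re_mul_cos_linePath γ κ y
  set ζ2 := linePath γ κ y
  -- Above the line point, cos(Im ζ) only decreases, so the whole segment satisfies the cosine
  -- hypothesis of `norm_logIntegrand_le`.
  set T : Set ℂ := {ζ | ζ.re = R} ∩ ({ζ | ζ2.im ≤ ζ.im} ∩ {ζ | ζ.im < Real.pi}) with hT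
  have hTc : Convex ℝ T := by
    refine Convex.inter ?_ ((convex_halfSpace_im_ge _).inter (convex_halfSpace_im_lt _))
    exact convex_hyperplane (f := Complex.re) ⟨Complex.add_re, fun c x => by simp⟩ R
  have h1T : descentPath γ φ ∈ T := by
    refine ⟨descentPath_re γ φ, ?_, ?_⟩
    · rw [mem_ofPred_eq, descentPath_im]; linarith [him.2, hφ.1]
    · rw [mem_ofPred_eq, descentPath_im]; exact hφ.2
  have h2T : ζ2 ∈ T := ⟨hre, show ζ2.im ≤ ζ2.im from le_rfl, by rw [mem_ofPred_eq]; linarith [him.2, Real.pi_pos]⟩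
  have hbound : ∀ ζ ∈ T, ‖logIntegrand N γ θ ζ‖ ≤
      2 * Real.exp (N * Real.exp γ) * Real.exp (-N * Real.sinh γ * (R - γ)) := by
    rintro ζ ⟨hζr, hζ1, hζ2⟩
    rw [mem_ofPred_eq] at hζr hζ1 hζ2
    have := norm_logIntegrand_le (N := N) (γ := γ) (θ := θ) hN.le (ζ := ζ) (by linarith)
      (by linarith) (by
        rw [← hcosy, hζr, hre]
        exact mul_le_mul_of_nonneg_left
          (Real.cos_le_cos_of_nonneg_of_le_pi him.1.le hζ2.le hζ1) (Real.exp_pos _).le)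
    rwa [hζr] at this
  have hstrip : T ⊆ upperStrip := fun ζ hζ => ⟨him.1.trans_le hζ.2.1, hζ.2.2⟩
  have := hTc.norm_image_sub_le_of_norm_hasDerivWithin_le (f := Φ)
    (fun ζ hζ => (hΦ ζ (hstrip hζ)).hasDerivWithinAt) hbound h2T h1T
  refine this.trans (mul_le_mul_of_nonneg_left ?_ (by positivity))
  have hdiff : descentPath γ φ - ζ2 = ((φ - ζ2.im : ℝ) : ℂ) * Complex.I := by
    apply Complex.ext
    · simp [descentPath_re, hre, R]
    · simp [descentPath_im]
  rw [hdiff, norm_mul, Complex.norm_I, mul_one, Complex.norm_real, Real.norm_eq_abs, abs_le]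
  constructor <;> linarith [him.1, him.2, hφ.1, hφ.2, Real.pi_pos]

theorem tendsto_descentPath_zero (γ : ℝ) : Tendsto (descentPath γ) (𝓝[>] 0) (𝓝 γ) := by
  have h1 : Tendsto (r γ) (𝓝[>] 0) (𝓝 γ) := by
    have := (continuousAt_r (γ := γ) le_rfl Real.pi_pos).tendsto.mono_left
      (nhdsWithin_le_nhds (s := Ioi 0))
    rwa [r_zero] at this
  have h2 : Tendsto (fun φ : ℝ => (φ : ℂ) * Complex.I) (𝓝[>] 0) (𝓝 0) := by
    have : Tendsto (fun φ : ℝ => (φ : ℂ) * Complex.I) (𝓝 0) (𝓝 ((0 : ℝ) * Complex.I)) :=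
      Continuous.tendsto (by fun_prop) _
    simpa using this.mono_left nhdsWithin_le_nhds
  simpa using! ((Complex.continuous_ofReal.tendsto γ).comp h1).add h2

/-- Both curves start at γ, which is not the pole since θ ≠ γ. The integrand is bounded on a small
ball, whose intersection with the strip is convex. -/
theorem tendsto_primitive_sub_zero {N γ θ κ : ℝ} (hθ : θ ≠ γ) (hκ : 0 < κ) {Φ : ℂ → ℂ}
    (hΦ : ∀ ζ ∈ upperStrip, HasDerivAt Φ (logIntegrand N γ θ ζ) ζ) :
    Tendsto (fun φ => Φ (descentPath γ φ) - Φ (linePath γ κ φ)) (𝓝[>] 0) (𝓝 0) := by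
  obtain ⟨M, δ, hδ, hM⟩ := exists_bound_logIntegrand_nhds N hθ
  have h1 := tendsto_descentPath_zero γ
  have h2 : Tendsto (linePath γ κ) (𝓝[>] 0) (𝓝 γ) := by
    have := ((continuous_linePath γ κ).tendsto 0).mono_left (nhdsWithin_le_nhds (s := Ioi 0))
    rwa [linePath_zero] at this
  have h3 : Tendsto (fun φ => M * ‖descentPath γ φ - linePath γ κ φ‖) (𝓝[>] 0) (𝓝 0) := by
    simpa using (h1.sub h2).norm.const_mul M
  refine squeeze_zero_norm' ?_ h3
  have hball := Metric.ball_mem_nhds (γ : ℂ) hδ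
  filter_upwards [h1 hball, h2 hball, Ioo_mem_nhdsGT Real.pi_pos] with φ hφ1 hφ2 hφ
  exact ((convex_ball (γ : ℂ) δ).inter convex_upperStrip).norm_image_sub_le_of_norm_hasDerivWithin_le
    (fun ζ hζ => (hΦ ζ hζ.2).hasDerivWithinAt) (fun ζ hζ => hM ζ hζ.1)
    ⟨hφ2, linePath_mem γ hκ hφ.1⟩ ⟨hφ1, descentPath_mem hφ⟩

/-- The contour shift in terms of primitives: A along the path and B along the line agree
asymptotically at both ends, so a bound on the increments of A passes to the integral of J. No
integral along the path is formed, and no integrability there is needed. The sign of η selects an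
upper or a lower bound. -/
theorem mul_im_integral_le_of_asymptotic {A B J : ℝ → ℂ} {Y D : ℝ → ℝ} {η d₀ d₁ : ℝ}
    (hJ : Integrable J) (hB : ∀ y, 0 < y → HasDerivAt B (J y) y)
    (hY : Tendsto Y (𝓝[<] Real.pi) atTop)
    (htop : Tendsto (fun φ => A φ - B (Y φ)) (𝓝[<] Real.pi) (𝓝 0))
    (hbot : Tendsto (fun φ => A φ - B φ) (𝓝[>] 0) (𝓝 0))
    (hmono : ∀ a b, 0 < a → a ≤ b → b < Real.pi → η * ((A b).im - (A a).im) ≤ D b - D a)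
    (hd₀ : Tendsto D (𝓝[>] 0) (𝓝 d₀)) (hd₁ : Tendsto D (𝓝[<] Real.pi) (𝓝 d₁)) :
    η * (∫ y in Ioi 0, J y).im ≤ d₁ - d₀ := by
  have him : ∀ {l : Filter ℝ} {f : ℝ → ℂ} {z : ℂ}, Tendsto f l (𝓝 z) →
      Tendsto (fun x => η * (f x).im) l (𝓝 (η * z.im)) := fun hf =>
    ((Complex.continuous_im.tendsto _).comp hf).const_mul η
  have step1 : ∀ a ∈ Ioo 0 Real.pi, η * (∫ y in Ioi a, J y).im ≤
      d₁ - D a + η * (A a - B a).im := by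
    intro a ha
    have h1 := him (intervalIntegral_tendsto_integral_Ioi a hJ.integrableOn hY)
    have h2 : Tendsto (fun b => D b - D a + η * (A a - B a).im - η * (A b - B (Y b)).im)
        (𝓝[<] Real.pi) (𝓝 (d₁ - D a + η * (A a - B a).im - η * (0 : ℂ).im)) :=
      ((hd₁.sub_const _).add_const _).sub (him htop)
    rw [Complex.zero_im, mul_zero, sub_zero] at h2
    refine le_of_tendsto_of_tendsto h1 h2 ?_
    filter_upwards [Ioo_mem_nhdsLT ha.2, hY.eventually_ge_atTop a] with b hb hYb
    have h3 : ∫ y in a..Y b, J y = B (Y b) - B a := by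
      apply intervalIntegral.integral_eq_sub_of_hasDerivAt
      · intro y hy
        rw [uIcc_of_le hYb] at hy
        exact hB y (ha.1.trans_le hy.1)
      · exact hJ.intervalIntegrable
    rw [h3]
    have := hmono a b ha.1 hb.1.le hb.2
    simp only [Complex.sub_im]
    linarith
  have h1 : Tendsto (fun a => η * (∫ y in Ioi a, J y).im) (𝓝[>] 0)
      (𝓝 (η * (∫ y in Ioi 0, J y).im)) := by
    apply him
    have h2 : ∀ a : ℝ, ∫ y in Ioi a, J y = (∫ y in Ioi 0, J y) - ∫ y in (0:ℝ)..a, J y := by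
      intro a
      rw [← intervalIntegral.integral_interval_add_Ioi' (a := 0) (b := a) hJ.intervalIntegrable
        hJ.integrableOn, add_sub_cancel_left]
    refine Tendsto.congr (fun a => (h2 a).symm) ?_
    have h3 := (intervalIntegral.continuous_primitive (fun a b => hJ.intervalIntegrable
      (a := a) (b := b)) 0).tendsto 0
    rw [intervalIntegral.integral_same] at h3
    simpa using (h3.mono_left (nhdsWithin_le_nhds (s := Ioi 0))).const_sub (∫ y in Ioi 0, J y)
  have h2 : Tendsto (fun a => d₁ - D a + η * (A a - B a).im) (𝓝[>] 0)
      (𝓝 (d₁ - d₀ + η * (0 : ℂ).im)) := (hd₀.const_sub d₁).add (him hbot)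
  rw [Complex.zero_im, mul_zero, add_zero] at h2
  refine le_of_tendsto_of_tendsto h1 h2 ?_
  filter_upwards [Ioo_mem_nhdsGT Real.pi_pos] with a ha using step1 a ha

/-- Bounds on the integrand along the path of steepest descent bound the integral along the
vertical line. -/
theorem mul_im_integral_le {N γ κ Ω : ℝ} {e : Err} (hN : 0 < N) (hγ : 0 < γ) (hκ : 0 < κ)
    (hθ : theta Ω e γ ≠ γ) {J : ℝ → ℂ} (hJ : Integrable J)
    (hJeq : ∀ y, 0 < y → J y = logIntegrand N γ (theta Ω e γ) (linePath γ κ y) *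
      (κ * Complex.I / (Real.exp γ + κ * y * Complex.I)))
    {D D' : ℝ → ℝ} {η d₀ d₁ : ℝ} (hD : ∀ φ ∈ Ioo 0 Real.pi, HasDerivAt D (D' φ) φ)
    (hle : ∀ φ ∈ Ioo 0 Real.pi, η * (Real.exp (-N * h γ φ) * gTilde Ω e γ φ) ≤ D' φ)
    (hd₀ : Tendsto D (𝓝[>] 0) (𝓝 d₀)) (hd₁ : Tendsto D (𝓝[<] Real.pi) (𝓝 d₁)) :
    η * (∫ y in Ioi 0, J y).im ≤ d₁ - d₀ := by
  obtain ⟨Φ, hΦ⟩ := exists_primitive_logIntegrand N γ (theta Ω e γ)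
  have hA : ∀ φ ∈ Ioo 0 Real.pi, HasDerivAt (fun φ => (Φ (descentPath γ φ)).im)
      (Real.exp (-N * h γ φ) * gTilde Ω e γ φ) φ := by
    intro φ hφ
    have h1 : HasDerivAt (fun φ => Φ (descentPath γ φ)) _ φ :=
      (hΦ _ (descentPath_mem hφ)).comp φ (hasDerivAt_descentPath hγ hφ)
    rw [← im_logIntegrand_descentPath N hφ]
    exact Complex.imCLM.hasFDerivAt.comp_hasDerivAt φ h1
  refine mul_im_integral_le_of_asymptotic (A := fun φ => Φ (descentPath γ φ))
    (B := fun y => Φ (linePath γ κ y)) (D := D)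
    (Y := fun φ => √(Real.exp (r γ φ) ^ 2 - Real.exp γ ^ 2) / κ) hJ ?_ ?_
    (tendsto_primitive_sub_top hN hγ hκ hΦ) (tendsto_primitive_sub_zero hθ hκ hΦ) ?_ hd₀ hd₁
  · intro y hy
    rw [hJeq y hy]
    exact (hΦ _ (linePath_mem γ hκ hy)).comp y (hasDerivAt_linePath γ κ y)
  · refine Tendsto.atTop_div_const hκ (Real.tendsto_sqrt_atTop.comp ?_)
    refine tendsto_atTop_add_const_right _ _ ?_
    exact (tendsto_pow_atTop two_ne_zero).comp (Real.tendsto_exp_atTop.comp (tendsto_r_pi hγ))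
  · intro a b ha hab hb
    have hsub : Icc a b ⊆ Ioo 0 Real.pi := fun x hx => ⟨ha.trans_le hx.1, hx.2.trans_lt hb⟩
    have hdiff : ∀ x ∈ Icc a b, HasDerivAt
        (fun φ => D φ - η * (Φ (descentPath γ φ)).im)
        (D' x - η * (Real.exp (-N * h γ x) * gTilde Ω e γ x)) x := fun x hx =>
      (hD x (hsub hx)).sub ((hA x (hsub hx)).const_mul η)
    have hm : MonotoneOn (fun φ => D φ - η * (Φ (descentPath γ φ)).im) (Icc a b) := by
      refine monotoneOn_of_deriv_nonneg (convex_Icc a b)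
        (fun x hx => (hdiff x hx).continuousAt.continuousWithinAt)
        (fun x hx => (hdiff x (interior_subset hx)).differentiableAt.differentiableWithinAt)
        fun x hx => ?_
      rw [(hdiff x (interior_subset hx)).deriv, sub_nonneg]
      exact hle x (hsub (interior_subset hx))
    have := hm ⟨le_rfl, hab⟩ ⟨hab, le_rfl⟩ hab
    simp only at this
    linarith

/-! ### The inverse function `t` and the sign of c_0 -/

theorem re_cpow_half_nonneg (w : ℂ) : 0 ≤ (w ^ (1 / 2 : ℂ)).re := by
  rcases eq_or_ne w 0 with rfl | hw
  · simp
  · rw [Complex.cpow_def_of_ne_zero hw, Complex.exp_re]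
    have h1 : (Complex.log w * (1 / 2 : ℂ)).im = w.arg / 2 := by
      have : (1 / 2 : ℂ) = ((1 / 2 : ℝ) : ℂ) := by push_cast; rfl
      rw [this, Complex.im_mul_ofReal, Complex.log_im]; ring
    rw [h1]
    refine mul_nonneg (Real.exp_pos _).le (Real.cos_nonneg_of_mem_Icc ⟨?_, ?_⟩) <;>
    linarith [Complex.neg_pi_lt_arg w, Complex.arg_le_pi w]

theorem cpow_half_sq (w : ℂ) : (w ^ (1 / 2 : ℂ)) ^ 2 = w := by
  rw [one_div]
  exact Complex.cpow_nat_inv_pow w two_ne_zero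

/-- A principal square root has nonnegative real part, so when the value x is real and nonzero its
sign must be that of Im z. -/
theorem tInv_eq_real {γ x : ℝ} {z : ℂ} (hx : x ≠ 0) (hz : tInv γ z = x) :
    2 * alphaC γ (Complex.log z) = ((x ^ 2 : ℝ) : ℂ) ∧ 0 < x * z.im := by
  unfold tInv at hz
  have hre := re_cpow_half_nonneg (2 * alphaC γ (Complex.log z))
  have hsq := cpow_half_sq (2 * alphaC γ (Complex.log z))
  set q := (2 * alphaC γ (Complex.log z)) ^ (1 / 2 : ℂ)
  rcases lt_trichotomy z.im 0 with h | h | h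
  · rw [Real.sign_of_neg h] at hz
    have hq : q = ((-x : ℝ) : ℂ) := by push_cast at hz ⊢; rw [← hz]; ring
    rw [hq, Complex.ofReal_re] at hre
    constructor
    · rw [← hsq, hq]; push_cast; ring
    · have : x < 0 := lt_of_le_of_ne (by linarith) hx
      exact mul_pos_of_neg_of_neg this h
  · rw [h, Real.sign_zero] at hz
    simp at hz
    exact absurd hz.symm (by exact_mod_cast hx)
  · rw [Real.sign_of_pos h] at hz
    have hq : q = (x : ℂ) := by rw [← hz]; push_cast; ring
    rw [hq, Complex.ofReal_re] at hre
    constructor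
    · rw [← hsq, hq]; push_cast; ring
    · exact mul_pos (lt_of_le_of_ne hre hx.symm) h

theorem alphaC_conj (γ : ℝ) (ζ : ℂ) :
    alphaC γ ((starRingEnd ℂ) ζ) = (starRingEnd ℂ) (alphaC γ ζ) := by
  simp only [alphaC, map_add, map_sub, map_mul, ← Complex.cosh_conj, ← Complex.sinh_conj,
    Complex.conj_ofReal]

theorem tInv_conj {γ x : ℝ} {z : ℂ} (hx : x ≠ 0) (hz : tInv γ z = x) :
    tInv γ ((starRingEnd ℂ) z) = ((-x : ℝ) : ℂ) := by
  obtain ⟨h1, h2⟩ := tInv_eq_real hx hz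
  have him : z.im ≠ 0 := by rintro h; simp [h] at h2
  have harg : z.arg ≠ Real.pi := fun h => him (Complex.arg_eq_pi_iff.1 h).2
  have h3 : 2 * alphaC γ (Complex.log ((starRingEnd ℂ) z)) = 2 * alphaC γ (Complex.log z) := by
    rw [Complex.log_conj _ harg, alphaC_conj]
    have := congrArg (starRingEnd ℂ) h1
    rw [map_mul, Complex.conj_ofReal, ← h1, Complex.conj_ofNat] at this
    exact this
  rw [Complex.ofReal_neg, ← hz, tInv, tInv, h3, Complex.conj_im, Real.sign_neg]
  push_cast
  ring

theorem tInv_exp_descentPath {γ φ : ℝ} (hγ : 0 < γ) (hφ : φ ∈ Ioo 0 Real.pi) :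
    tInv γ (Complex.exp (descentPath γ φ)) = u γ φ := by
  have him : 0 < (Complex.exp (descentPath γ φ)).im := by
    rw [Complex.exp_im, descentPath_im]
    exact mul_pos (Real.exp_pos _) (Real.sin_pos_of_pos_of_lt_pi hφ.1 hφ.2)
  rw [tInv, Complex.log_exp (by rw [descentPath_im]; linarith [hφ.1, Real.pi_pos])
    (by rw [descentPath_im]; exact hφ.2.le), Real.sign_of_pos him, alphaC_descentPath hφ, u,
    Real.sqrt_eq_rpow, Complex.ofReal_cpow (mul_pos two_pos (h_pos hγ hφ)).le]
  push_cast
  simp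

/-- Uniqueness: α(log z) being real forces log z onto the path at angle arg z, and strict
monotonicity of u identifies the angle. -/
theorem eq_exp_descentPath {γ φ : ℝ} {z : ℂ} (hγ : 0 < γ) (hφ : φ ∈ Ioo 0 Real.pi)
    (hz : tInv γ z = u γ φ) : z = Complex.exp (descentPath γ φ) := by
  have hu := u_pos hγ hφ
  obtain ⟨h1, h2⟩ := tInv_eq_real hu.ne' hz
  have him : 0 < z.im := pos_of_mul_pos_right h2 hu.le
  have hz0 : z ≠ 0 := by rintro rfl; simp at him
  have harg : z.arg ∈ Ioo 0 Real.pi := by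
    refine ⟨lt_of_le_of_ne (Complex.arg_nonneg_iff.2 him.le) fun h => ?_,
      lt_of_le_of_ne (Complex.arg_le_pi z) fun h => ?_⟩
    · exact him.ne' (Complex.arg_eq_zero_iff.1 h.symm).2
    · exact him.ne' (Complex.arg_eq_pi_iff.1 h).2
  have h3 : alphaC γ (Complex.log z) = ((u γ φ ^ 2 / 2 : ℝ) : ℂ) := by
    push_cast at h1 ⊢
    rw [← h1]; ring
  have h4 : Complex.log z = descentPath γ z.arg := by
    have h5 := congrArg Complex.im h3
    rw [im_alphaC, Complex.ofReal_im, Complex.log_im] at h5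
    apply Complex.ext
    · rw [descentPath_re]
      apply Real.sinh_injective
      have hs := Real.sin_pos_of_pos_of_lt_pi harg.1 harg.2
      apply mul_right_cancel₀ hs.ne'
      rw [sinh_r_mul_sin harg]
      linarith
    · rw [descentPath_im, Complex.log_im]
  have h6 : u γ z.arg = u γ φ := by
    have h7 := congrArg Complex.re h3
    rw [h4, alphaC_descentPath harg, Complex.ofReal_re, Complex.ofReal_re] at h7
    have h8 := u_sq hγ harg
    have h9 := u_pos hγ harg
    rw [← sq_eq_sq₀ h9.le hu.le]
    linarith
  have h10 := (strictMonoOn_u hγ).injOn (Ioo_subset_Ico_self harg) (Ioo_subset_Ico_self hφ) h6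
  rw [← h10, ← h4, Complex.exp_log hz0]

/-- The choice made by `Classical.epsilon` is meaningful because a solution exists: on the path for
x > 0, on its conjugate for x < 0. -/
theorem tInv_t {γ x : ℝ} (hγ : 0 < γ) (hx : x ≠ 0) : tInv γ (t γ x) = x := by
  rw [t, if_neg hx]
  apply Classical.epsilon_spec (p := fun z : ℂ => tInv γ z = (x : ℂ))
  rcases hx.lt_or_gt with h | h
  · obtain ⟨φ, hφ, he⟩ := exists_u_eq hγ (neg_pos.2 h)
    have := tInv_conj (u_pos hγ hφ).ne' (tInv_exp_descentPath hγ hφ)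
    rw [he, neg_neg] at this
    exact ⟨_, this⟩
  · obtain ⟨φ, hφ, he⟩ := exists_u_eq hγ h
    exact ⟨_, by rw [tInv_exp_descentPath hγ hφ, he]⟩

theorem t_u {γ φ : ℝ} (hγ : 0 < γ) (hφ : φ ∈ Ioo 0 Real.pi) :
    t γ (u γ φ) = Complex.exp (descentPath γ φ) :=
  eq_exp_descentPath hγ hφ (tInv_t hγ (u_pos hγ hφ).ne')

theorem t_neg {γ x : ℝ} (hγ : 0 < γ) (hx : 0 < x) : t γ (-x) = (starRingEnd ℂ) (t γ x) := by
  obtain ⟨φ, hφ, he⟩ := exists_u_eq hγ hx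
  have h1 := tInv_conj (neg_ne_zero.2 hx.ne') (tInv_t hγ (neg_ne_zero.2 hx.ne'))
  rw [neg_neg, ← he] at h1
  have h2 := eq_exp_descentPath hγ hφ h1
  rw [← t_u hγ hφ, he] at h2
  rw [← h2, Complex.conj_conj]

theorem tendsto_exp_descentPath_slope {γ : ℝ} (hγ : 0 < γ) :
    Tendsto (fun φ : ℝ => (Complex.exp (descentPath γ φ) - Complex.exp γ) / φ) (𝓝[>] 0)
      (𝓝 (Complex.exp γ * Complex.I)) := by
  have h1 : HasDerivWithinAt (descentPath γ) Complex.I (Ici 0) 0 := by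
    have e1 := (hasDerivWithinAt_r_zero hγ).ofReal_comp
    have e2 := ((Complex.ofRealCLM.hasDerivAt (x := 0)).mul_const Complex.I).hasDerivWithinAt
      (s := Ici (0:ℝ))
    simpa using! e1.add e2
  have h2 := h1.cexp
  rw [← hasDerivWithinAt_Ioi_iff_Ici, hasDerivWithinAt_iff_tendsto_slope' self_notMem_Ioi] at h2
  have h0 : descentPath γ 0 = γ := by simp [descentPath, r_zero]
  rw [h0] at h2
  refine h2.congr fun φ => ?_
  rw [slope_def_module, h0, sub_zero, Complex.real_smul, Complex.ofReal_inv, div_eq_inv_mul]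

theorem tendsto_t_slope {γ : ℝ} (hγ : 0 < γ) :
    Tendsto (fun x : ℝ => (t γ x - Complex.exp γ) / x) (𝓝[>] 0)
      (𝓝 (Complex.exp γ * Complex.I / √(Real.cosh γ))) := by
  -- g inverts u. Since g(x) tends to 0 with x, the slope of t is the quotient of the slopes of
  -- exp(descentPath) and u, both taken in φ.
  choose! g hg hgu using fun (x : ℝ) (hx : 0 < x) => exists_u_eq hγ hx
  have hg0 : Tendsto g (𝓝[>] 0) (𝓝[>] 0) := by
    rw [tendsto_nhdsWithin_iff]
    constructor
    · rw [Metric.tendsto_nhds]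
      intro ε hε
      set ε' := min ε (Real.pi / 2) with hε'
      have hε0 : 0 < ε' := by positivity
      have hεπ : ε' < Real.pi := (min_le_right _ _).trans_lt (by linarith [Real.pi_pos])
      filter_upwards [Ioo_mem_nhdsGT (u_pos hγ ⟨hε0, hεπ⟩)] with x hx
      have h1 := hg x hx.1
      have h2 : g x < ε' := by
        rw [← (strictMonoOn_u hγ).lt_iff_lt (Ioo_subset_Ico_self h1) ⟨hε0.le, hεπ⟩, hgu x hx.1]
        exact hx.2
      rw [Real.dist_eq, sub_zero, abs_of_pos h1.1]
      exact h2.trans_le (min_le_left _ _)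
    · filter_upwards [self_mem_nhdsWithin] with x hx using (hg x hx).1
  have hc : (√(Real.cosh γ) : ℂ) ≠ 0 := by
    rw [Complex.ofReal_ne_zero]
    have := Real.cosh_pos γ
    positivity
  have h1 := ((tendsto_exp_descentPath_slope hγ).div
    ((Complex.continuous_ofReal.tendsto _).comp (tendsto_u_div hγ)) hc).comp hg0
  refine h1.congr' ?_
  filter_upwards [self_mem_nhdsWithin] with x hx
  have hgx := (hg x hx).1
  have hux := u_pos hγ (hg x hx)
  have htx := t_u hγ (hg x hx)
  have e1 : (g x : ℂ) ≠ 0 := by exact_mod_cast hgx.ne'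
  have e2 : (u γ (g x) : ℂ) ≠ 0 := by exact_mod_cast hux.ne'
  simp only [Function.comp, Pi.div_apply, Complex.ofReal_div]
  rw [← htx, div_div_div_cancel_right₀ e1, hgu x hx]

/-- The left derivative follows from the right one by t(-x) = conj t(x): a purely imaginary slope is
fixed by minus conjugation. -/
theorem hasDerivAt_t {γ : ℝ} (hγ : 0 < γ) :
    HasDerivAt (t γ) (Complex.exp γ * Complex.I / √(Real.cosh γ)) 0 := by
  have ht0 : t γ 0 = Complex.exp γ := by simp [t]
  have hslope : ∀ x, slope (t γ) 0 x = (t γ x - Complex.exp γ) / x := fun x => by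
    rw [slope_def_module, ht0, sub_zero, Complex.real_smul, Complex.ofReal_inv, div_eq_inv_mul]
  rw [hasDerivAt_iff_tendsto_slope, ← nhdsLT_sup_nhdsGT, tendsto_sup, funext hslope]
  refine ⟨?_, tendsto_t_slope hγ⟩
  have hneg : Tendsto (fun x : ℝ => -x) (𝓝[<] 0) (𝓝[>] 0) := by
    simpa using tendsto_neg_nhdsLT (a := (0:ℝ))
  have h1 := ((Complex.continuous_conj.tendsto _).comp ((tendsto_t_slope hγ).comp hneg)).neg
  have h2 : -(starRingEnd ℂ) (Complex.exp γ * Complex.I / √(Real.cosh γ)) =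
      Complex.exp γ * Complex.I / √(Real.cosh γ) := by
    rw [map_div₀, map_mul, ← Complex.exp_conj, Complex.conj_ofReal, Complex.conj_ofReal,
      Complex.conj_I]
    ring
  rw [h2] at h1
  refine h1.congr' ?_
  filter_upwards [self_mem_nhdsWithin] with x hx
  have hx' : 0 < -x := neg_pos.2 hx
  have h3 := t_neg hγ hx'
  rw [neg_neg] at h3
  simp only [Function.comp]
  rw [h3, map_div₀, map_sub, ← Complex.exp_conj, Complex.conj_ofReal, Complex.conj_ofReal,
    Complex.ofReal_neg, div_neg, neg_neg]

/-- c_0 = t'(0) / (i (exp θ - exp γ)), whose sign is that of θ - γ. The higher coefficients enter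
the argument as arbitrary real numbers. -/
theorem coeff_zero {Ω γ : ℝ} {e : Err} (hγ : 0 < γ) :
    coeff Ω e γ 0 = Real.exp γ / √(Real.cosh γ) / (Real.exp (theta Ω e γ) - Real.exp γ) := by
  have ht0 : t γ 0 = Complex.exp γ := by simp [t]
  rw [coeff, iteratedDeriv_zero, f, (hasDerivAt_t hγ).deriv, ht0]
  have : Complex.exp γ * Complex.I / √(Real.cosh γ) / (Complex.exp (theta Ω e γ) - Complex.exp γ) /
      ((Nat.factorial 0 : ℂ) * Complex.I) =
      ((Real.exp γ / √(Real.cosh γ) / (Real.exp (theta Ω e γ) - Real.exp γ) : ℝ) : ℂ) := by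
    push_cast
    rw [Nat.factorial_zero, Nat.cast_one, one_mul]
    field_simp [Complex.I_ne_zero]
  rw [this, Complex.ofReal_re]

theorem coeff_zero_pos {Ω γ : ℝ} {e : Err} (hγ : 0 < γ) (hθ : γ < theta Ω e γ) :
    0 < coeff Ω e γ 0 := by
  rw [coeff_zero hγ]
  have := Real.cosh_pos γ
  have := sub_pos.2 (Real.exp_lt_exp.2 hθ)
  positivity

theorem coeff_zero_neg {Ω γ : ℝ} {e : Err} (hγ : 0 < γ) (hθ : theta Ω e γ < γ) :
    coeff Ω e γ 0 < 0 := by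
  rw [coeff_zero hγ]
  have := Real.cosh_pos γ
  have := sub_neg.2 (Real.exp_lt_exp.2 hθ)
  exact div_neg_of_pos_of_neg (by positivity) this

/-! ### Gaussian moments and the truncated series -/

theorem integrable_pow_mul_exp_neg_sq {b : ℝ} (hb : 0 < b) (k : ℕ) :
    Integrable fun x : ℝ => x ^ (2 * k) * Real.exp (-b * x ^ 2) := by
  have := integrable_rpow_mul_exp_neg_mul_sq hb (s := ((2 * k : ℕ) : ℝ))
    (by have : (0 : ℝ) ≤ ((2 * k : ℕ) : ℝ) := Nat.cast_nonneg _
        linarith)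
  simpa only [Real.rpow_natCast] using this

theorem integral_pow_mul_exp_neg_sq {b : ℝ} (hb : 0 < b) (k : ℕ) :
    ∫ x in Ioi (0 : ℝ), x ^ (2 * k) * Real.exp (-b * x ^ 2) =
      1 / 2 * Real.Gamma ((k : ℝ) + 1 / 2) * (1 / b) ^ ((k : ℝ) + 1 / 2) := by
  have h1 := integral_rpow_mul_exp_neg_mul_rpow (p := 2) (q := ((2 * k : ℕ) : ℝ)) two_pos
    (by have : (0 : ℝ) ≤ ((2 * k : ℕ) : ℝ) := Nat.cast_nonneg _
        linarith) hb
  have h2 : ((2 * k : ℕ) + 1 : ℝ) / 2 = (k : ℝ) + 1 / 2 := by push_cast; ring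
  simp only [Real.rpow_natCast, Real.rpow_two] at h1
  rw [h1, neg_div, h2, Real.rpow_neg hb.le, one_div b, Real.inv_rpow hb.le]
  ring

/-- The partial sum of even order of the Taylor series. -/
noncomputable def evenSum (Ω : ℝ) (e : Err) (K : ℕ) (γ x : ℝ) : ℝ :=
  ∑ k ∈ Finset.range K, coeff Ω e γ (2 * k) * x ^ (2 * k)

theorem coeff_zero_mul_taylorSum {Ω γ : ℝ} {e : Err} {K : ℕ} (hK : 1 ≤ K)
    (h0 : coeff Ω e γ 0 ≠ 0) (φ : ℝ) :
    coeff Ω e γ 0 * taylorSum Ω e K γ φ = evenSum Ω e K γ (u γ φ) := by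
  obtain ⟨K, rfl⟩ : ∃ m, K = m + 1 := ⟨K - 1, by omega⟩
  rw [taylorSum, evenSum, Finset.sum_range_succ', Nat.add_sub_cancel, mul_add, mul_one,
    Finset.mul_sum, add_comm]
  congr 1
  · rw [Finset.range_eq_Ico, Finset.sum_Ico_add' (fun k => coeff Ω e γ (2 * k) * u γ φ ^ (2 * k))]
    rw [show Finset.Ico (0 + 1) (K + 1) = Finset.Icc 1 K by ext; simp]
    refine Finset.sum_congr rfl fun k _ => ?_
    field_simp
  · simp

theorem integrable_evenSum_mul_exp {N : ℝ} (hN : 0 < N) (Ω : ℝ) (e : Err) (K : ℕ) (γ : ℝ) :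
    Integrable fun x => evenSum Ω e K γ x * Real.exp (-(N / 2) * x ^ 2) := by
  simp only [evenSum, Finset.sum_mul, mul_assoc]
  exact integrable_finsetSum _ fun k _ =>
    (integrable_pow_mul_exp_neg_sq (by positivity) k).const_mul _

theorem integral_evenSum_mul_exp {n : ℕ} (hn : 1 ≤ n) {γ : ℝ} (hγ : 0 < γ) (Ω : ℝ) (e : Err)
    (K : ℕ) :
    ∫ x in Ioi 0, evenSum Ω e K γ x * Real.exp (-(n / (2 * Real.sinh γ) / 2) * x ^ 2) =
      Real.pi * gSeries n Ω e K γ := by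
  have hs : 0 < Real.sinh γ := Real.sinh_pos_iff.2 hγ
  have hn0 : (0 : ℝ) < n := by exact_mod_cast hn
  have hb : 0 < n / (2 * Real.sinh γ) / 2 := by positivity
  simp only [evenSum, Finset.sum_mul, mul_assoc]
  rw [integral_finsetSum _ fun k _ =>
    ((integrable_pow_mul_exp_neg_sq hb k).const_mul _).integrableOn, gSeries, Finset.mul_sum,
    Finset.mul_sum]
  refine Finset.sum_congr rfl fun k _ => ?_
  rw [integral_const_mul, integral_pow_mul_exp_neg_sq hb, Real.Gamma_one_half_eq]
  have h1 : 1 / ((n : ℝ) / (2 * Real.sinh γ) / 2) = 4 * Real.sinh γ / n := by field_simp; norm_num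
  rw [h1]
  have h2 : √Real.pi * √Real.pi = Real.pi := Real.mul_self_sqrt Real.pi_pos.le
  have h3 : 0 < √Real.pi := Real.sqrt_pos.2 Real.pi_pos
  field_simp
  rw [sq, h2]

/-- Bounds on `c` by partial sums of its Taylor series bound the inversion integral by the
asymptotic series. -/
theorem mul_im_integral_le_gSeries {n : ℕ} (hn : 1 ≤ n) {γ κ Ω : ℝ} {e : Err} (hγ : 0 < γ)
    (hκ : 0 < κ) (hθ : theta Ω e γ ≠ γ) {J : ℝ → ℂ} (hJ : Integrable J)
    (hJeq : ∀ y, 0 < y → J y = logIntegrand (n / (2 * Real.sinh γ)) γ (theta Ω e γ)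
      (linePath γ κ y) * (κ * Complex.I / (Real.exp γ + κ * y * Complex.I)))
    {η : ℝ} {K : ℕ}
    (hle : ∀ φ ∈ Ioo 0 Real.pi, η * c Ω e γ φ ≤ η * evenSum Ω e K γ (u γ φ)) :
    η * (∫ y in Ioi 0, J y).im ≤ η * (Real.pi * gSeries n Ω e K γ) := by
  have hs : 0 < Real.sinh γ := Real.sinh_pos_iff.2 hγ
  have hn0 : (0 : ℝ) < n := by exact_mod_cast hn
  set N : ℝ := n / (2 * Real.sinh γ) with hNdef
  have hN : 0 < N := by positivity
  -- The comparison function on the path is η ∫₀^{u(φ)} W. Since u' = h' / u, g̃ = c u' and exp(-N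
  -- h) = exp(-N u² / 2), the bound on c is exactly the required bound on derivatives; u runs from 0
  -- to infinity.
  set W : ℝ → ℝ := fun x => evenSum Ω e K γ x * Real.exp (-(N / 2) * x ^ 2) with hW
  have hWc : Continuous W := by
    unfold W evenSum; fun_prop
  have hWi : Integrable W := integrable_evenSum_mul_exp hN Ω e K γ
  have hprim : ∀ x, HasDerivAt (fun x => ∫ z in (0:ℝ)..x, W z) (W x) x := fun x =>
    intervalIntegral.integral_hasDerivAt_right hWi.intervalIntegrable
      (hWc.stronglyMeasurableAtFilter _ _) hWc.continuousAt
  have hd₀ : Tendsto (fun φ => η * ∫ z in (0:ℝ)..u γ φ, W z) (𝓝[>] 0) (𝓝 (η * 0)) := by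
    refine Tendsto.const_mul η ?_
    have h1 := (hprim 0).continuousAt.tendsto
    rw [intervalIntegral.integral_same] at h1
    have h2 := (continuousAt_u (γ := γ) le_rfl Real.pi_pos).tendsto.mono_left
      (nhdsWithin_le_nhds (s := Ioi 0))
    rw [u_zero] at h2
    exact h1.comp h2
  have hd₁ : Tendsto (fun φ => η * ∫ z in (0:ℝ)..u γ φ, W z) (𝓝[<] Real.pi)
      (𝓝 (η * ∫ z in Ioi 0, W z)) :=
    (intervalIntegral_tendsto_integral_Ioi 0 hWi.integrableOn (tendsto_u_pi hγ)).const_mul η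
  have hD : ∀ φ ∈ Ioo 0 Real.pi, HasDerivAt (fun φ => η * ∫ z in (0:ℝ)..u γ φ, W z)
      (η * (W (u γ φ) * (hDeriv γ φ / u γ φ))) φ := fun φ hφ =>
    ((hprim (u γ φ)).comp φ (hasDerivAt_u hγ hφ)).const_mul η
  have key := mul_im_integral_le hN hγ hκ hθ hJ hJeq hD (η := η) ?_ hd₀ hd₁
  · rw [mul_zero, sub_zero] at key
    rwa [← integral_evenSum_mul_exp hn hγ Ω e K]
  · intro φ hφ
    have hu := u_pos hγ hφ
    have hh := hDeriv_pos (γ := γ) hφ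
    have h1 : gTilde Ω e γ φ = c Ω e γ φ * (hDeriv γ φ / u γ φ) := by
      rw [c]; field_simp
    have h2 : -(N / 2) * u γ φ ^ 2 = -N * h γ φ := by rw [u_sq hγ hφ]; ring
    simp only [hW, h2, h1]
    have h3 := mul_le_mul_of_nonneg_right (hle φ hφ)
      (show 0 ≤ Real.exp (-N * h γ φ) * (hDeriv γ φ / u γ φ) by positivity)
    linarith

/-! ### From the Laplace variable to the logarithmic coordinate -/

/-- With w = 1 + 2Vp = exp(ζ - θ), the term -(n/2) log w gives the linear part of α, while the terms
in w and 1/w combine to cosh ζ; the values of ρ and S are those for which the two have equal weight.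
The measure dp / p becomes -dζ / (exp(θ - ζ) - 1), and the constants left over form the exponent n v
/ 2. -/
theorem inversion_integrand_eq {n : ℕ} {γ θ V S ρ a y : ℝ} (hγ : 0 < γ) (hV : 0 < V) (hy : 0 < y)
    (ha : 1 + 2 * V * a = Real.exp (γ - θ))
    (hS : S / (2 * V) = n / 2 * (Real.exp (-θ) / (2 * Real.sinh γ)))
    (hρ : ρ / (2 * V) = n / 2 * (Real.exp θ / (2 * Real.sinh γ))) :
    -Complex.I * Real.exp (1 / 2 * n * (-alpha γ θ / Real.sinh γ)) *
      (Complex.exp ((a + y * Complex.I) * ρ) *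
        (Complex.exp (-(n / 2) * Complex.log (1 + 2 * V * (a + y * Complex.I)) +
        (1 / (1 + 2 * V * (a + y * Complex.I)) - 1) * (S / (2 * V))) / (a + y * Complex.I))) =
    logIntegrand (n / (2 * Real.sinh γ) : ℝ) γ θ (linePath γ (2 * V * Real.exp θ) y) *
      ((2 * V * Real.exp θ : ℝ) * Complex.I /
        (Real.exp γ + (2 * V * Real.exp θ : ℝ) * y * Complex.I)) := by
  have hs : 0 < Real.sinh γ := Real.sinh_pos_iff.2 hγ
  set κ : ℝ := 2 * V * Real.exp θ with hκdef
  have hκ : 0 < κ := by positivity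
  set ζ := linePath γ κ y with hζ
  have hexpζ : Complex.exp ζ = Real.exp γ + κ * y * Complex.I := exp_linePath γ κ y
  set p : ℂ := a + y * Complex.I with hp
  set w : ℂ := 1 + 2 * V * p with hw
  have hwζ : Complex.exp (ζ - θ) = w := by
    have hθ0 : Complex.exp θ ≠ 0 := Complex.exp_ne_zero _
    have ha' := congrArg (fun x : ℝ => (x : ℂ)) ha
    push_cast at ha'
    rw [Complex.exp_sub] at ha' ⊢
    rw [hexpζ, hw, hp, mul_add, ← add_assoc, ha', hκdef]
    push_cast
    field_simp
  have him := linePath_im_mem γ hκ hy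
  -- The line lies in 0 < Im ζ < π/2, so the principal logarithm undoes the exponential.
  have hlog : Complex.log w = ζ - θ := by
    rw [← hwζ, Complex.log_exp]
    · simp; linarith [him.1, Real.pi_pos]
    · simp; linarith [him.2, Real.pi_pos]
  have hw0 : w ≠ 0 := by rw [← hwζ]; exact Complex.exp_ne_zero _
  have hp0 : p ≠ 0 := by
    intro h0
    have := congrArg Complex.im h0
    simp [hp] at this
    exact hy.ne' this
  have hV0 : (V : ℂ) ≠ 0 := by exact_mod_cast hV.ne'
  have hs0 : Complex.sinh γ ≠ 0 := by
    rw [← Complex.ofReal_sinh]; exact_mod_cast hs.ne'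
  have hw1 : w - 1 ≠ 0 := by
    rw [hw, add_sub_cancel_left]
    exact mul_ne_zero (mul_ne_zero two_ne_zero hV0) hp0
  have hden : Complex.exp (θ - ζ) = 1 / w := by
    rw [← hwζ, ← neg_sub ζ, Complex.exp_neg, one_div]
  have hlin : (Real.exp γ + κ * y * Complex.I : ℂ) = Complex.exp θ * w := by
    rw [← hexpζ, ← hwζ, ← Complex.exp_add]; congr 1; ring
  have hcosh : Complex.cosh ζ = (Complex.exp θ * w + Complex.exp (-θ) / w) / 2 := by
    rw [Complex.cosh, ← hwζ, ← Complex.exp_add, ← Complex.exp_sub]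
    congr 3 <;> ring_nf
  have hS' := congrArg (fun x : ℝ => (x : ℂ)) hS
  have hρ' := congrArg (fun x : ℝ => (x : ℂ)) hρ
  push_cast at hS' hρ'
  have hpρ : p * ρ = (w - 1) * (n / 2 * (Complex.exp θ / (2 * Complex.sinh γ))) := by
    rw [← hρ', hw]; field_simp; ring
  have hcoshθ : Complex.cosh θ = (Complex.exp θ + Complex.exp (-θ)) / 2 := rfl
  have hexponent : (1 / 2 * n * (-alpha γ θ / Real.sinh γ) : ℝ) + (p * ρ + (-(n / 2) *
      Complex.log w + (1 / w - 1) * (S / (2 * V)))) =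
      -((n / (2 * Real.sinh γ) : ℝ) : ℂ) * alphaC γ ζ := by
    rw [hpρ, hS', hlog, alphaC, hcosh, alpha]
    push_cast
    rw [hcoshθ]
    field_simp
    ring
  have hnum : (Real.exp (1 / 2 * n * (-alpha γ θ / Real.sinh γ)) : ℂ) * (Complex.exp (p * ρ) *
      Complex.exp (-(n / 2) * Complex.log w + (1 / w - 1) * (S / (2 * V)))) =
      Complex.exp (-((n / (2 * Real.sinh γ) : ℝ) : ℂ) * alphaC γ ζ) := by
    rw [← hexponent, Complex.ofReal_exp, ← Complex.exp_add, ← Complex.exp_add]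
  rw [logIntegrand, ← hnum, hden, hlin, hκdef]
  have hθ0 : Complex.exp θ ≠ 0 := Complex.exp_ne_zero _
  have hp' : p = (w - 1) / (2 * V) := by rw [hw]; field_simp; ring
  have h1w : 1 / w - 1 ≠ 0 := by
    rw [div_sub_one hw0]
    exact div_ne_zero (by rw [← neg_sub]; exact neg_ne_zero.2 hw1) hw0
  generalize Complex.exp (p * ρ) = E1
  generalize Complex.exp (-(n / 2) * Complex.log w + (1 / w - 1) * (S / (2 * V))) = E2
  generalize (Real.exp (1 / 2 * n * (-alpha γ θ / Real.sinh γ)) : ℂ) = E3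
  have h2 : 1 / w - 1 = -(w - 1) / w := by field_simp; ring
  rw [hp', h2]
  push_cast
  field_simp

/-- A bound on `c` by a partial sum of its Taylor series gives the corresponding bound on the
tail probability of the squared norm of a normal vector. -/
theorem mul_prob_le_gSeries {n : ℕ} (hn : 1 ≤ n) (m d : Fin n → ℝ) {V : ℝ≥0} (hV : V ≠ 0)
    {γ Ω ρ : ℝ} {e : Err} (hγ : 0 < γ) (hθ : theta Ω e γ ≠ γ)
    (hS : sqDist d m / (2 * V) = n / 2 * (Real.exp (-theta Ω e γ) / (2 * Real.sinh γ)))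
    (hρ : ρ / (2 * V) = n / 2 * (Real.exp (theta Ω e γ) / (2 * Real.sinh γ)))
    {η : ℝ} {K : ℕ}
    (hle : ∀ φ ∈ Ioo 0 Real.pi, η * c Ω e γ φ ≤ η * evenSum Ω e K γ (u γ φ)) :
    η * ((if γ < theta Ω e γ then 1 else 0) - (gaussianVec m V).real {y | sqDist d y ≤ ρ}) ≤
      η * (gSeries n Ω e K γ * Real.exp (-(1 / 2) * (n : ℝ) * v Ω e γ)) := by
  have hs : 0 < Real.sinh γ := Real.sinh_pos_iff.2 hγ
  have hn0 : (0 : ℝ) < n := by exact_mod_cast hn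
  have hV0 : 0 < (V : ℝ) := by positivity
  set θ := theta Ω e γ with hθdef
  have hρ0 : 0 < ρ := by
    have h1 : 0 < ρ / (2 * V) := by rw [hρ]; positivity
    exact (div_pos_iff_of_pos_right (by positivity)).1 h1
  -- This abscissa makes the line pass through the saddle point ζ = γ at y = 0. It avoids the pole p
  -- = 0 because θ ≠ γ, and lies to its left exactly when γ < θ.
  set a : ℝ := (Real.exp (γ - θ) - 1) / (2 * V) with ha
  have hw : 1 + 2 * V * a = Real.exp (γ - θ) := by rw [ha]; field_simp; ring
  have ha0 : a ≠ 0 := by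
    refine div_ne_zero (sub_ne_zero.2 fun h1 => ?_) (by positivity)
    rw [Real.exp_eq_one_iff, sub_eq_zero] at h1
    exact hθ h1.symm
  have hneg : a < 0 ↔ γ < θ := by
    rw [ha, div_lt_iff₀ (by positivity : (0:ℝ) < 2 * V), zero_mul, sub_neg,
      Real.exp_lt_one_iff, sub_neg]
  obtain ⟨hMi, hM⟩ := sqDistLaw_eq_re_integral hn m d hV ha0 (by rw [hw]; positivity) hρ0
  simp only [hneg] at hM
  have key := mul_im_integral_le_gSeries hn (κ := 2 * V * Real.exp θ) hγ (by positivity) hθ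
    (hMi.const_mul (-Complex.I * Real.exp (1 / 2 * n * (-alpha γ θ / Real.sinh γ))))
    (fun y hy => inversion_integrand_eq hγ hV0 hy hw hS hρ) hle
  have hexp : Real.exp (1 / 2 * n * (-alpha γ θ / Real.sinh γ)) *
      Real.exp (-(1 / 2) * (n : ℝ) * v Ω e γ) = 1 := by
    rw [← Real.exp_add, v, ← hθdef, Real.exp_eq_one_iff]; ring
  rw [integral_const_mul] at key
  have him : ∀ I0 : ℂ, (-Complex.I * Real.exp (1 / 2 * n * (-alpha γ θ / Real.sinh γ)) * I0).im =
      -(Real.exp (1 / 2 * n * (-alpha γ θ / Real.sinh γ)) * I0.re) := by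
    intro I0
    rw [mul_assoc, Complex.mul_im, Complex.re_ofReal_mul]
    simp [-Complex.ofReal_exp]
  rw [him, ← hM] at key
  have hpos := Real.exp_pos (-(1 / 2) * (n : ℝ) * v Ω e γ)
  have key2 := mul_le_mul_of_nonneg_right key hpos.le
  have hπ := Real.pi_pos
  set G := (gaussianVec m V).real {y | sqDist d y ≤ ρ} - (if γ < θ then 1 else 0)
  have e1 : η * -(Real.exp (1 / 2 * n * (-alpha γ θ / Real.sinh γ)) * (Real.pi * G)) *
      Real.exp (-(1 / 2) * (n : ℝ) * v Ω e γ) = Real.pi * (η * -G) := by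
    linear_combination (-(η * Real.pi * G)) * hexp
  rw [e1] at key2
  have key3 : Real.pi * (η * -G) ≤ Real.pi *
      (η * (gSeries n Ω e K γ * Real.exp (-(1 / 2) * (n : ℝ) * v Ω e γ))) := by
    linarith
  have key4 := le_of_mul_le_mul_left key3 hπ
  rwa [neg_sub] at key4

/-! ### The trade-off between the two error probabilities -/

/-- The inequality need not order the thresholds. If l < l', however, the slab l ≤ g < l' must be
μ-null, hence ν-null, and replacing l by l' costs nothing under ν. -/
theorem measureReal_le_of_lt_le {X : Type*} [MeasurableSpace X] {μ ν : Measure X}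
    [IsFiniteMeasure μ] [IsFiniteMeasure ν] (hνμ : ν ≪ μ) {g : X → ℝ} (hg : Measurable g)
    {l l' : ℝ} (hle : μ.real {y | g y < l'} ≤ μ.real {y | g y < l}) :
    ν.real {y | l ≤ g y} ≤ ν.real {y | l' ≤ g y} := by
  rcases le_or_gt l' l with hl | hl
  · exact measureReal_mono fun y (hy : l ≤ g y) => hl.trans hy
  · have hm : MeasurableSet {y | l ≤ g y ∧ g y < l'} :=
      (measurableSet_le measurable_const hg).inter (measurableSet_lt hg measurable_const)
    have h1 : {y | g y < l'} = {y | g y < l} ∪ {y | l ≤ g y ∧ g y < l'} := by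
      ext y
      simp only [mem_ofPred_eq, mem_union]
      exact ⟨fun h => (lt_or_ge (g y) l).imp id fun h' => ⟨h', h⟩,
        fun h => h.elim (fun h => h.trans hl) fun h => h.2⟩
    have hd : Disjoint {y | g y < l} {y | l ≤ g y ∧ g y < l'} :=
      disjoint_left.2 fun y (hy : g y < l) (hy' : l ≤ g y ∧ g y < l') => hy.not_ge hy'.1
    rw [h1, measureReal_union hd hm] at hle
    have h2 : μ.real {y | l ≤ g y ∧ g y < l'} = 0 :=
      le_antisymm (by linarith) measureReal_nonneg
    rw [measureReal_eq_zero_iff] at h2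
    have h3 : ν.real {y | l ≤ g y ∧ g y < l'} = 0 := by
      rw [measureReal_eq_zero_iff]; exact hνμ h2
    have h4 : {y | l ≤ g y} ⊆ {y | l' ≤ g y} ∪ {y | l ≤ g y ∧ g y < l'} := fun y (hy : l ≤ g y) =>
      (le_or_gt l' (g y)).imp id fun h => ⟨hy, h⟩
    have h5 := (measureReal_mono (μ := ν) h4).trans (measureReal_union_le _ _)
    linarith

theorem measureReal_lt_le_of_le {X : Type*} [MeasurableSpace X] {μ ν : Measure X}
    [IsProbabilityMeasure μ] [IsProbabilityMeasure ν] (hμν : μ ≪ ν) {g : X → ℝ}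
    (hg : Measurable g) {l l' : ℝ} (hle : ν.real {y | l' ≤ g y} ≤ ν.real {y | l ≤ g y}) :
    μ.real {y | g y < l} ≤ μ.real {y | g y < l'} := by
  have hcompl : ∀ (ξ : Measure X) [IsProbabilityMeasure ξ] (b : ℝ),
      ξ.real {y | b ≤ g y} = 1 - ξ.real {y | g y < b} := by
    intro ξ _ b
    rw [← probReal_compl_eq_one_sub (measurableSet_lt hg measurable_const)]
    congr 1; ext y; simp
  have h1 := measureReal_le_of_lt_le (l := l') (l' := l) hμν hg
    (by rw [hcompl, hcompl] at hle; linarith)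
  rw [hcompl, hcompl] at h1
  linarith

/-! ### The range of γ and the geometry of the likelihood ratio -/

theorem snr_pos {σx σw : ℝ≥0} (hσx : 0 < σx) (hσw : 0 < σw) : 0 < snr σx σw := by
  unfold snr
  have : (0 : ℝ) < σx := hσx
  have : (0 : ℝ) < σw := hσw
  positivity

theorem pos_of_inRange {Ω γ : ℝ} (hΩ : 0 < Ω) (hγ : InRange Ω γ) : 0 < γ := by
  have h1 : 0 < Real.log (1 + Ω / (1 + Ω)) :=
    Real.log_pos (by have : 0 < Ω / (1 + Ω) := by positivity
                     linarith)
  exact lt_trans (by positivity) hγ.1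

theorem two_mul_sinh_mul_exp (γ : ℝ) : 2 * Real.sinh γ * Real.exp γ = Real.exp (2 * γ) - 1 := by
  have : Real.exp (-γ) * Real.exp γ = 1 := by rw [← Real.exp_add]; simp
  rw [Real.sinh_eq, two_mul γ, Real.exp_add]
  linarith

theorem theta_MD (Ω γ : ℝ) : theta Ω Err.MD γ = Real.log (Ω / (2 * Real.sinh γ)) := by
  simp [theta]

theorem exp_theta_MD {Ω γ : ℝ} (hΩ : 0 < Ω) (hγ : 0 < γ) :
    Real.exp (theta Ω Err.MD γ) = Ω / (2 * Real.sinh γ) := by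
  have hs : 0 < Real.sinh γ := Real.sinh_pos_iff.2 hγ
  rw [theta_MD, Real.exp_log (by positivity)]

theorem exp_theta_FA {Ω γ : ℝ} (hΩ : 0 < Ω) (hγ : 0 < γ) :
    Real.exp (theta Ω Err.FA γ) = Ω / (2 * Real.sinh γ) / (1 + Ω) := by
  have hs : 0 < Real.sinh γ := Real.sinh_pos_iff.2 hγ
  rw [theta, Real.exp_add, Real.exp_neg, Real.exp_log (by positivity),
    Real.exp_log (by positivity), div_eq_mul_inv _ (1 + Ω)]

/-- Since 2 sinh γ exp γ = exp(2γ) - 1, the upper end of the range is exactly the condition γ < θ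
for MD; in the same way the lower end is θ < γ for FA. -/
theorem lt_theta_MD {Ω γ : ℝ} (hΩ : 0 < Ω) (hγ : InRange Ω γ) : γ < theta Ω Err.MD γ := by
  have hγ0 := pos_of_inRange hΩ hγ
  have hs : 0 < Real.sinh γ := Real.sinh_pos_iff.2 hγ0
  rw [← Real.exp_lt_exp, exp_theta_MD hΩ hγ0, lt_div_iff₀ (by positivity), mul_comm,
    two_mul_sinh_mul_exp]
  have h1 : 2 * γ < Real.log (1 + Ω) := by linarith [hγ.2]
  rw [Real.lt_log_iff_exp_lt (by positivity)] at h1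
  linarith

theorem theta_FA_lt {Ω γ : ℝ} (hΩ : 0 < Ω) (hγ : InRange Ω γ) : theta Ω Err.FA γ < γ := by
  have hγ0 := pos_of_inRange hΩ hγ
  have hs : 0 < Real.sinh γ := Real.sinh_pos_iff.2 hγ0
  rw [← Real.exp_lt_exp, exp_theta_FA hΩ hγ0, div_div, mul_comm (2 * Real.sinh γ), ← div_div,
    div_lt_iff₀ (by positivity), mul_comm, two_mul_sinh_mul_exp]
  have h1 : Real.log (1 + Ω / (1 + Ω)) < 2 * γ := by linarith [hγ.1]
  rw [Real.log_lt_iff_lt_exp (by positivity)] at h1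
  linarith

/-- The point from which the likelihood ratio depends on the distance only. -/
noncomputable def center {n : ℕ} (σx σw : ℝ≥0) (x : Fin n → ℝ) : Fin n → ℝ :=
  fun i => ((σx : ℝ) ^ 2 + (σw : ℝ) ^ 2) / (σx : ℝ) ^ 2 * x i

theorem log_gaussianPDFReal (m : ℝ) {V : ℝ≥0} (hV : V ≠ 0) (y : ℝ) :
    Real.log (gaussianPDFReal m V y) =
      -(1 / 2) * Real.log (2 * Real.pi * V) - (y - m) ^ 2 / (2 * V) := by
  have hV0 : 0 < (V : ℝ) := by positivity
  have : 0 < 2 * Real.pi * (V : ℝ) := by positivity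
  rw [gaussianPDFReal, Real.log_mul (by positivity) (Real.exp_pos _).ne', Real.log_exp,
    Real.log_inv, Real.log_sqrt this.le]
  ring

/-- Completing the square in the difference of the two Gaussian exponents. The power constraint on x
turns the leftover constant into 1/2. -/
theorem logLikelihood_eq {n : ℕ} (hn : 1 ≤ n) {σx σw : ℝ≥0} (hσx : 0 < σx) (hσw : 0 < σw)
    {x : Fin n → ℝ} (hx : ∑ i, x i ^ 2 = (n : ℝ) * (σx : ℝ) ^ 2) (y : Fin n → ℝ) :
    logLikelihood σx σw x y = 1 / 2 * Real.log (1 + snr σx σw) + 1 / 2 -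
      (σx : ℝ) ^ 2 / (2 * (σw : ℝ) ^ 2 * ((σx : ℝ) ^ 2 + (σw : ℝ) ^ 2)) / n *
        sqDist (center σx σw x) y := by
  have hn0 : (0 : ℝ) < n := by exact_mod_cast hn
  have hx0 : (0 : ℝ) < σx := hσx
  have hw0 : (0 : ℝ) < σw := hσw
  have hV1 : σw ^ 2 ≠ 0 := by positivity
  have hV2 : σx ^ 2 + σw ^ 2 ≠ 0 := by positivity
  have hp1 : ∀ i ∈ Finset.univ, gaussianPDFReal (x i) (σw ^ 2) (y i) ≠ 0 := fun i _ =>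
    (gaussianPDFReal_pos _ _ _ hV1).ne'
  have hp2 : ∀ i ∈ Finset.univ, gaussianPDFReal 0 (σx ^ 2 + σw ^ 2) (y i) ≠ 0 := fun i _ =>
    (gaussianPDFReal_pos _ _ _ hV2).ne'
  have hlog : Real.log (1 + snr σx σw) = Real.log (2 * Real.pi * ((σx : ℝ) ^ 2 + (σw : ℝ) ^ 2)) -
      Real.log (2 * Real.pi * (σw : ℝ) ^ 2) := by
    rw [← Real.log_div (by positivity) (by positivity), snr]
    congr 1
    field_simp
    ring
  have hpt : ∀ i, Real.log (gaussianPDFReal (x i) (σw ^ 2) (y i)) -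
      Real.log (gaussianPDFReal 0 (σx ^ 2 + σw ^ 2) (y i)) =
      1 / 2 * Real.log (1 + snr σx σw) + 1 / (2 * (σx : ℝ) ^ 2) * x i ^ 2 -
      (σx : ℝ) ^ 2 / (2 * (σw : ℝ) ^ 2 * ((σx : ℝ) ^ 2 + (σw : ℝ) ^ 2)) *
        (y i - center σx σw x i) ^ 2 := by
    intro i
    rw [log_gaussianPDFReal _ hV1, log_gaussianPDFReal _ hV2, hlog, center]
    push_cast
    field_simp
    ring
  rw [logLikelihood, Real.log_div (Finset.prod_ne_zero_iff.2 hp1) (Finset.prod_ne_zero_iff.2 hp2),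
    Real.log_prod hp1, Real.log_prod hp2, ← Finset.sum_sub_distrib]
  simp only [hpt]
  rw [Finset.sum_sub_distrib, Finset.sum_add_distrib, Finset.sum_const, sqDist]
  simp only [← Finset.mul_sum, hx, Finset.card_univ, Fintype.card_fin, nsmul_eq_mul]
  generalize ∑ i, (y i - center σx σw x i) ^ 2 = T
  field_simp

/-- The squared distance that corresponds to the parameter `γ`. -/
noncomputable def sqRadius (n : ℕ) (σx : ℝ≥0) (γ : ℝ) : ℝ :=
  n * (σx : ℝ) ^ 2 / (4 * Real.sinh γ ^ 2)

/-- The threshold of the likelihood ratio that corresponds to the parameter `γ`. -/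
noncomputable def threshold (n : ℕ) (σx σw : ℝ≥0) (γ : ℝ) : ℝ :=
  1 / 2 * Real.log (1 + snr σx σw) + 1 / 2 -
      (σx : ℝ) ^ 2 / (2 * (σw : ℝ) ^ 2 * ((σx : ℝ) ^ 2 + (σw : ℝ) ^ 2)) / n *
        sqRadius n σx γ

theorem threshold_le_logLikelihood_iff {n : ℕ} (hn : 1 ≤ n) {σx σw : ℝ≥0} (hσx : 0 < σx)
    (hσw : 0 < σw) {x : Fin n → ℝ} (hx : ∑ i, x i ^ 2 = (n : ℝ) * (σx : ℝ) ^ 2) (γ : ℝ)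
    (y : Fin n → ℝ) : threshold n σx σw γ ≤ logLikelihood σx σw x y ↔
      sqDist (center σx σw x) y ≤ sqRadius n σx γ := by
  have hn0 : (0 : ℝ) < n := by exact_mod_cast hn
  have hx0 : (0 : ℝ) < σx := hσx
  have hw0 : (0 : ℝ) < σw := hσw
  rw [logLikelihood_eq hn hσx hσw hx, threshold, sub_le_sub_iff_left]
  exact mul_le_mul_iff_right₀ (by positivity)

theorem measurable_logLikelihood {n : ℕ} (σx σw : ℝ≥0) (x : Fin n → ℝ) :
    Measurable (logLikelihood σx σw x) := by
  unfold logLikelihood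
  have h1 := fun m V => measurable_gaussianPDFReal m V
  fun_prop

instance {n : ℕ} (σw : ℝ≥0) (x : Fin n → ℝ) : IsProbabilityMeasure (channelLaw σw x) := by
  unfold channelLaw; infer_instance

instance (n : ℕ) (σx σw : ℝ≥0) : IsProbabilityMeasure (auxLaw n σx σw) := by
  unfold auxLaw; infer_instance

theorem channelLaw_absolutelyContinuous {n : ℕ} {σx σw : ℝ≥0} (hσw : 0 < σw) (x : Fin n → ℝ) :
    channelLaw σw x ≪ auxLaw n σx σw :=
  (gaussianVec_absolutelyContinuous_volume x (by positivity)).trans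
    (volume_absolutelyContinuous_gaussianVec (fun _ => 0) (by positivity))

theorem auxLaw_absolutelyContinuous {n : ℕ} {σx σw : ℝ≥0} (hσw : 0 < σw) (x : Fin n → ℝ) :
    auxLaw n σx σw ≪ channelLaw σw x :=
  (gaussianVec_absolutelyContinuous_volume (fun _ => 0) (by positivity)).trans
    (volume_absolutelyContinuous_gaussianVec x (by positivity))

theorem pMD_eq_one_sub {n : ℕ} (σx σw : ℝ≥0) (x : Fin n → ℝ) (lam : ℝ) :
    pMD σx σw x lam = 1 - (channelLaw σw x).real {y | lam ≤ logLikelihood σx σw x y} := by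
  rw [pMD, ← probReal_compl_eq_one_sub (measurableSet_le measurable_const
    (measurable_logLikelihood σx σw x))]
  congr 1; ext y; simp

/-! ### Bounds at the matched threshold -/

/-- One radius `sqRadius` serves both hypotheses: passing from MD to FA multiplies the variance by 1
+ Ω and divides exp θ by 1 + Ω. In the stated range both unit steps vanish. -/
theorem mul_pMD_le {n : ℕ} (hn : 1 ≤ n) {σx σw : ℝ≥0} (hσx : 0 < σx) (hσw : 0 < σw)
    {x : Fin n → ℝ} (hx : ∑ i, x i ^ 2 = (n : ℝ) * (σx : ℝ) ^ 2) {γ η : ℝ} {K : ℕ}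
    (hγ : InRange (snr σx σw) γ)
    (hle : ∀ φ ∈ Ioo 0 Real.pi, η * c (snr σx σw) Err.MD γ φ ≤
      η * evenSum (snr σx σw) Err.MD K γ (u γ φ)) :
    η * pMD σx σw x (threshold n σx σw γ) ≤ η * pMDApprox n (snr σx σw) K γ := by
  have hx0 : (0 : ℝ) < σx := hσx
  have hw0 : (0 : ℝ) < σw := hσw
  have hΩ := snr_pos hσx hσw
  have hγ0 := pos_of_inRange hΩ hγ
  have hs : 0 < Real.sinh γ := Real.sinh_pos_iff.2 hγ0
  have hθ := lt_theta_MD hΩ hγ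
  have hS : sqDist (center σx σw x) x = n * (σw : ℝ) ^ 4 / (σx : ℝ) ^ 2 := by
    have : ∀ i, (x i - center σx σw x i) ^ 2 = (σw : ℝ) ^ 4 / (σx : ℝ) ^ 4 * x i ^ 2 := fun i => by
      rw [center]; field_simp; ring
    rw [sqDist]
    simp only [this]
    rw [← Finset.mul_sum, hx]
    field_simp
  have key := mul_prob_le_gSeries hn x (center σx σw x) (V := σw ^ 2) (by positivity) (Ω := snr σx σw)
    (e := Err.MD) (ρ := sqRadius n σx γ) hγ0 hθ.ne'
    (by rw [hS, Real.exp_neg, exp_theta_MD hΩ hγ0, snr]; push_cast; field_simp)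
    (by rw [exp_theta_MD hΩ hγ0, snr, sqRadius]; push_cast; field_simp; norm_num) hle
  rw [if_pos hθ] at key
  have hstep : step (sgn (snr σx σw) Err.MD γ) = 0 := by
    rw [sgn, Real.sign_of_neg (sub_neg.2 hθ), step, if_neg (by norm_num)]
  rw [pMD_eq_one_sub, pMDApprox, hstep, zero_add]
  simp only [threshold_le_logLikelihood_iff hn hσx hσw hx]
  exact key

theorem mul_pFA_le {n : ℕ} (hn : 1 ≤ n) {σx σw : ℝ≥0} (hσx : 0 < σx) (hσw : 0 < σw)
    {x : Fin n → ℝ} (hx : ∑ i, x i ^ 2 = (n : ℝ) * (σx : ℝ) ^ 2) {γ η : ℝ} {K : ℕ}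
    (hγ : InRange (snr σx σw) γ)
    (hle : ∀ φ ∈ Ioo 0 Real.pi, η * c (snr σx σw) Err.FA γ φ ≤
      η * evenSum (snr σx σw) Err.FA K γ (u γ φ)) :
    η * pFAApprox n (snr σx σw) K γ ≤ η * pFA σx σw x (threshold n σx σw γ) := by
  have hx0 : (0 : ℝ) < σx := hσx
  have hw0 : (0 : ℝ) < σw := hσw
  have hΩ := snr_pos hσx hσw
  have hγ0 := pos_of_inRange hΩ hγ
  have hs : 0 < Real.sinh γ := Real.sinh_pos_iff.2 hγ0
  have hθ := theta_FA_lt hΩ hγ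
  have hS : sqDist (center σx σw x) (fun _ => 0) =
      n * ((σx : ℝ) ^ 2 + (σw : ℝ) ^ 2) ^ 2 / (σx : ℝ) ^ 2 := by
    have : ∀ i, (0 - center σx σw x i) ^ 2 =
        ((σx : ℝ) ^ 2 + (σw : ℝ) ^ 2) ^ 2 / (σx : ℝ) ^ 4 * x i ^ 2 := fun i => by
      rw [center]; field_simp; ring
    rw [sqDist]
    simp only [this]
    rw [← Finset.mul_sum, hx]
    field_simp
  have key := mul_prob_le_gSeries hn (fun _ => 0) (center σx σw x) (V := σx ^ 2 + σw ^ 2)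
    (by positivity) (Ω := snr σx σw)
    (e := Err.FA) (ρ := sqRadius n σx γ) hγ0 hθ.ne
    (by rw [hS, Real.exp_neg, exp_theta_FA hΩ hγ0, snr]; push_cast; field_simp; ring)
    (by rw [exp_theta_FA hΩ hγ0, snr, sqRadius]; push_cast; field_simp; norm_num; ring) hle
  rw [if_neg hθ.not_gt] at key
  have hstep : step (-sgn (snr σx σw) Err.FA γ) = 0 := by
    rw [sgn, Real.sign_of_pos (sub_pos.2 hθ), step, if_neg (by norm_num)]
  rw [pFA, pFAApprox, hstep]
  simp only [threshold_le_logLikelihood_iff hn hσx hσw hx]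
  have : auxLaw n σx σw = gaussianVec (fun _ => 0) (σx ^ 2 + σw ^ 2) := rfl
  rw [this]
  linarith

/-- For FA two sign changes cancel: c_0 < 0 reverses the bound on c, and the series enters
`pFAApprox` with a minus sign. The same half of the condition thus bounds both probabilities from
the same side. -/
theorem approx_upper {n : ℕ} (hn : 1 ≤ n) {σx σw : ℝ≥0} (hσx : 0 < σx) (hσw : 0 < σw)
    {x : Fin n → ℝ} (hx : ∑ i, x i ^ 2 = (n : ℝ) * (σx : ℝ) ^ 2) {γ : ℝ} {U : ℕ} (hU : 1 ≤ U)
    (hγ : InRange (snr σx σw) γ) (hc : UpperCondition (snr σx σw) U γ) :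
    pMD σx σw x (threshold n σx σw γ) ≤ pMDApprox n (snr σx σw) U γ ∧
      pFA σx σw x (threshold n σx σw γ) ≤ pFAApprox n (snr σx σw) U γ := by
  have hΩ := snr_pos hσx hσw
  have hγ0 := pos_of_inRange hΩ hγ
  have h1 := coeff_zero_pos hγ0 (lt_theta_MD hΩ hγ)
  have h2 := coeff_zero_neg hγ0 (theta_FA_lt hΩ hγ)
  constructor
  · have := mul_pMD_le (η := 1) (K := U) hn hσx hσw hx hγ fun φ hφ => by
      have h3 := hc Err.MD φ hφ
      rw [div_le_iff₀' h1, coeff_zero_mul_taylorSum hU h1.ne'] at h3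
      linarith
    linarith
  · have := mul_pFA_le (η := -1) (K := U) hn hσx hσw hx hγ fun φ hφ => by
      have h3 := hc Err.FA φ hφ
      rw [div_le_iff_of_neg h2, mul_comm, coeff_zero_mul_taylorSum hU h2.ne] at h3
      linarith
    linarith

theorem approx_lower {n : ℕ} (hn : 1 ≤ n) {σx σw : ℝ≥0} (hσx : 0 < σx) (hσw : 0 < σw)
    {x : Fin n → ℝ} (hx : ∑ i, x i ^ 2 = (n : ℝ) * (σx : ℝ) ^ 2) {γ : ℝ} {L : ℕ} (hL : 1 ≤ L)
    (hγ : InRange (snr σx σw) γ) (hc : LowerCondition (snr σx σw) L γ) :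
    pMDApprox n (snr σx σw) L γ ≤ pMD σx σw x (threshold n σx σw γ) ∧
      pFAApprox n (snr σx σw) L γ ≤ pFA σx σw x (threshold n σx σw γ) := by
  have hΩ := snr_pos hσx hσw
  have hγ0 := pos_of_inRange hΩ hγ
  have h1 := coeff_zero_pos hγ0 (lt_theta_MD hΩ hγ)
  have h2 := coeff_zero_neg hγ0 (theta_FA_lt hΩ hγ)
  constructor
  · have := mul_pMD_le (η := -1) (K := L) hn hσx hσw hx hγ fun φ hφ => by
      have h3 := hc Err.MD φ hφ
      rw [le_div_iff₀' h1, coeff_zero_mul_taylorSum hL h1.ne'] at h3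
      linarith
    linarith
  · have := mul_pFA_le (η := 1) (K := L) hn hσx hσw hx hγ fun φ hφ => by
      have h3 := hc Err.FA φ hφ
      rw [le_div_iff_of_neg h2, mul_comm, coeff_zero_mul_taylorSum hL h2.ne] at h3
      linarith
    linarith

theorem pFA_le_of_pMD_le {n : ℕ} {σx σw : ℝ≥0} (hσw : 0 < σw) {x : Fin n → ℝ} {l l' : ℝ}
    (hle : pMD σx σw x l' ≤ pMD σx σw x l) : pFA σx σw x l ≤ pFA σx σw x l' :=
  measureReal_le_of_lt_le (auxLaw_absolutelyContinuous hσw x) (measurable_logLikelihood σx σw x) hle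

theorem pMD_le_of_pFA_le {n : ℕ} {σx σw : ℝ≥0} (hσw : 0 < σw) {x : Fin n → ℝ} {l l' : ℝ}
    (hle : pFA σx σw x l' ≤ pFA σx σw x l) : pMD σx σw x l ≤ pMD σx σw x l' :=
  measureReal_lt_le_of_le (channelLaw_absolutelyContinuous hσw x)
    (measurable_logLikelihood σx σw x) hle

theorem pFA_pos_of_pMD_lt_one {n : ℕ} {σx σw : ℝ≥0} (hσw : 0 < σw) {x : Fin n → ℝ} {l : ℝ}
    (hlt : pMD σx σw x l < 1) : 0 < pFA σx σw x l := by
  refine lt_of_le_of_ne measureReal_nonneg fun h0 => ?_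
  rw [pFA, eq_comm, measureReal_eq_zero_iff] at h0
  have h1 := channelLaw_absolutelyContinuous hσw x h0
  rw [pMD_eq_one_sub, (measureReal_eq_zero_iff).2 h1] at hlt
  linarith

end AWGN

/-! ### Comparison with the exact bounds -/

theorem corollary1 (n : ℕ) (hn : 1 ≤ n) (σx σw : ℝ≥0) (hσx : 0 < σx) (hσw : 0 < σw)
    (x : Fin n → ℝ) (hx : ∑ i, x i ^ 2 = (n : ℝ) * (σx : ℝ) ^ 2)
    (L U : ℕ) (hL : 1 ≤ L) (hU : 1 ≤ U) :
    (∀ Pe Rbar : ℝ, 0 < Pe → Pe < 1 → AWGN.IsRateBound σx σw x Pe Rbar →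
      (∀ γ RU : ℝ, AWGN.InRange (AWGN.snr σx σw) γ →
        AWGN.UpperCondition (AWGN.snr σx σw) U γ →
        AWGN.IsRateApprox n (AWGN.snr σx σw) U γ Pe RU → RU ≤ Rbar) ∧
      (∀ γ RL : ℝ, AWGN.InRange (AWGN.snr σx σw) γ →
        AWGN.LowerCondition (AWGN.snr σx σw) L γ →
        AWGN.IsRateApprox n (AWGN.snr σx σw) L γ Pe RL → Rbar ≤ RL)) ∧
    (∀ R Pbar : ℝ, 0 < R → AWGN.IsErrorBound σx σw x R Pbar →
      (∀ γ PL : ℝ, AWGN.InRange (AWGN.snr σx σw) γ →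
        AWGN.LowerCondition (AWGN.snr σx σw) L γ →
        AWGN.IsErrorApprox n (AWGN.snr σx σw) L γ R PL → PL ≤ Pbar) ∧
      (∀ γ PU : ℝ, AWGN.InRange (AWGN.snr σx σw) γ →
        AWGN.UpperCondition (AWGN.snr σx σw) U γ →
        AWGN.IsErrorApprox n (AWGN.snr σx σw) U γ R PU → Pbar ≤ PU)) := by
  have hn0 : (0 : ℝ) < n := by exact_mod_cast hn
  have hlogb : ∀ {p q : ℝ}, 0 < p → p ≤ q →
      -(1 / (n : ℝ)) * Real.logb 2 q ≤ -(1 / (n : ℝ)) * Real.logb 2 p := fun hp hpq =>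
    mul_le_mul_of_nonpos_left (Real.logb_le_logb_of_le one_lt_two hp hpq)
      (by rw [neg_nonpos]; positivity)
  refine ⟨?_, ?_⟩
  · rintro Pe Rbar - hPe1 ⟨lam, hlam, rfl⟩
    -- A vanishing P_FA would force P_MD = 1 by absolute continuity; positivity is needed for the
    -- logarithm to be monotone.
    have hpos : 0 < AWGN.pFA σx σw x lam := AWGN.pFA_pos_of_pMD_lt_one hσw (hlam ▸ hPe1)
    refine ⟨?_, ?_⟩
    · rintro γ RU hγ hc ⟨hMD, -, rfl⟩
      obtain ⟨h1, h2⟩ := AWGN.approx_upper hn hσx hσw hx hU hγ hc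
      rw [hMD, ← hlam] at h1
      exact hlogb hpos ((AWGN.pFA_le_of_pMD_le hσw h1).trans h2)
    · rintro γ RL hγ hc ⟨hMD, hFA, rfl⟩
      obtain ⟨h1, h2⟩ := AWGN.approx_lower hn hσx hσw hx hL hγ hc
      rw [hMD, ← hlam] at h1
      exact hlogb hFA (h2.trans (AWGN.pFA_le_of_pMD_le hσw h1))
  · rintro R Pbar hR ⟨lam, hlam, rfl⟩
    -- With the convention `Real.logb 2 0 = 0`, a vanishing P_FA would give R = 0, which R > 0
    -- excludes.
    have hpos : 0 < AWGN.pFA σx σw x lam := by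
      refine lt_of_le_of_ne MeasureTheory.measureReal_nonneg fun h0 => ?_
      rw [← h0, Real.logb_zero, mul_zero] at hlam
      exact hR.ne hlam
    have heq : ∀ {p : ℝ}, 0 < p → -(1 / (n : ℝ)) * Real.logb 2 p = R →
        p = AWGN.pFA σx σw x lam := fun hp hpR =>
      Real.logb_injOn_pos one_lt_two hp hpos
        (mul_left_cancel₀ (neg_ne_zero.2 (by positivity : (1 / (n : ℝ)) ≠ 0)) (hpR.trans hlam.symm))
    refine ⟨?_, ?_⟩
    · rintro γ PL hγ hc ⟨hFA, hR', rfl⟩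
      obtain ⟨h1, h2⟩ := AWGN.approx_lower hn hσx hσw hx hL hγ hc
      rw [heq hFA hR'] at h2
      exact h1.trans (AWGN.pMD_le_of_pFA_le hσw h2)
    · rintro γ PU hγ hc ⟨hFA, hR', rfl⟩
      obtain ⟨h1, h2⟩ := AWGN.approx_upper hn hσx hσw hx hU hγ hc
      rw [heq hFA hR'] at h2
      exact (AWGN.pMD_le_of_pFA_le hσw h2).trans h1
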